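/- Let $R>1$, $D=B_1$ and $\Omega=B_R$ be the open balls of radii $1$ and $R$ centred at the origin of $\mathbb R^3$. Call a field $\mathbf E\in H_0(\mathrm{curl};\Omega)$, $\mathbf E\not\equiv 0$, an eigenfunction with eigenvalue $\lambda\neq 0$ of the limiting Maxwell problem $$\nabla\times\nabla\times\mathbf E=\lambda 1_D\mathbf E\ \text{ in }\Omega,\qquad \mathbf E\times\nu_\Omega=0\ \text{ on }\partial\Omega,$$ if $\int_\Omega(\nabla\times\mathbf E)\cdot(\nabla\times\mathbf F)\,dx=\lambda\int_D\mathbf E\cdot\mathbf F\,dx$ for all $\mathbf F\in H_0(\mathrm{curl};\Omega)$, where $H_0(\mathrm{curl};\Omega)$ is the space of square integrable (real) vector fields on $\Omega$ with square integrable weak curl and vanishing tangential trace on $\partial\Omega$. Call $\mathbf E$ electrostatic if $\nabla\times\mathbf E=0$ almost everywhere in the shell $\Omega\setminus\overline D$. Then there are eigenfunctions that are not electrostatic, and infinitely many positive numbers $\lambda$ are eigenvalues with such an eigenfunction. More precisely, let $p\ge 1$ be an integer, let $Y\neq 0$ be a real spherical harmonic of degree $p$ (the restriction to the unit sphere of a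 harmonic homogeneous polynomial of degree $p$), put $U=\frac{1}{\sqrt{p(p+1)}}\nabla_{\mathbb S^2}Y$ and $V(\omega)=\omega\times U(\omega)$, let $j_p$ be the spherical Bessel function of the first kind, and let $C,D_p$ be the solution of $$C+D_p=-\sqrt{p(p+1)},\qquad C R^p+D_pR^{-p-1}=0 .$$ Then there are infinitely many $k>0$ with $j_p(k)\neq0$ such that the field $$\mathbf E(r\omega)=-\frac{j_p(kr)}{j_p(k)}V(\omega)\quad(0\le r\le 1),\qquad \mathbf E(r\omega)=\frac{1}{\sqrt{p(p+1)}}\bigl(C r^p+D_p r^{-p-1}\bigr)V(\omega)\quad(1<r<R),\qquad |\omega|=1,$$ is an eigenfunction with eigenvalue $\lambda=k^2$ that is not electrostatic. -/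

import Mathlib

open MeasureTheory
open scoped ContDiff

noncomputable section

namespace MaxwellENZ

/-- Euclidean space `ℝ³`; vector fields are functions `E3 → E3`. -/
abbrev E3 : Type := EuclideanSpace ℝ (Fin 3)

/-- The vector product on `ℝ³`. -/
def cross (u v : E3) : E3 :=
  !₂[u 1 * v 2 - u 2 * v 1, u 2 * v 0 - u 0 * v 2, u 0 * v 1 - u 1 * v 0]

/-- The partial derivative `∂ᵢ φⱼ` at `x`. -/
def partialDeriv (φ : E3 → E3) (i j : Fin 3) (x : E3) : ℝ :=
  fderiv ℝ (fun y => φ y j) x (EuclideanSpace.single i 1)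

/-- The classical curl of a (differentiable) vector field; used for smooth test fields only. -/
def curl (φ : E3 → E3) (x : E3) : E3 :=
  !₂[partialDeriv φ 1 2 x - partialDeriv φ 2 1 x,
     partialDeriv φ 2 0 x - partialDeriv φ 0 2 x,
     partialDeriv φ 0 1 x - partialDeriv φ 1 0 x]

/-- `H` is the distributional curl of `E` in the open set `Ω`. -/
def IsWeakCurl (Ω : Set E3) (E H : E3 → E3) : Prop :=
  ∀ φ : E3 → E3, ContDiff ℝ ∞ φ → HasCompactSupport φ → tsupport φ ⊆ Ω →
    ∫ x in Ω, inner ℝ (H x) (φ x) = ∫ x in Ω, inner ℝ (E x) (curl φ x)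

/-- `ν_Ω × E = 0` on `∂Ω` for a field `E` in `H(curl, Ω)` with curl `H`: the tangential trace is
the functional `φ ↦ ∫_Ω (H · φ - E · curl φ)`, where `φ` is smooth up to the boundary (Green's
formula); the test fields do not have to vanish on `∂Ω`. -/
def TangentialTraceZero (Ω : Set E3) (E H : E3 → E3) : Prop :=
  ∀ φ : E3 → E3, ContDiff ℝ ∞ φ → HasCompactSupport φ →
    ∫ x in Ω, inner ℝ (H x) (φ x) = ∫ x in Ω, inner ℝ (E x) (curl φ x)

/-- `E` belongs to `H₀(curl, Ω)` and `H = ∇ × E`: both are square integrable, `H` is the weak curl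
of `E` in `Ω`, and the tangential trace of `E` on `∂Ω` is zero. -/
structure MemH0Curl (Ω : Set E3) (E H : E3 → E3) : Prop where
  memLp : MemLp E 2 (volume.restrict Ω)
  memLp_curl : MemLp H 2 (volume.restrict Ω)
  isWeakCurl : IsWeakCurl Ω E H
  trace_zero : TangentialTraceZero Ω E H

/-- `E`, with `H = ∇ × E`, is an eigenfunction with nonzero eigenvalue `lam` of the limiting problem
`∇ × ∇ × E = lam 1_D E` in `Ω`, `E × ν_Ω = 0` on `∂Ω`, in the weak sense: `E ∈ H₀(curl, Ω)` is
nonzero and `∫_Ω (∇ × E) · (∇ × F) = lam ∫_D E · F` for all `F ∈ H₀(curl, Ω)`. -/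
structure IsEigenfunction (D Ω : Set E3) (lam : ℝ) (E H : E3 → E3) : Prop where
  mem : MemH0Curl Ω E H
  eigenvalue_ne_zero : lam ≠ 0
  ne_zero : ¬ E =ᵐ[volume.restrict Ω] 0
  weak_eq : ∀ F G : E3 → E3, MemH0Curl Ω F G →
    ∫ x in Ω, inner ℝ (H x) (G x) = lam * ∫ x in D, inner ℝ (E x) (F x)

/-- The magnetic field `H` vanishes (almost everywhere) in the shell `Ω \ closure D`. -/
def IsElectrostatic (D Ω : Set E3) (H : E3 → E3) : Prop :=
  H =ᵐ[volume.restrict (Ω \ closure D)] 0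

/-- The spherical Bessel function of the first kind,
`j_p(x) = ∑ₘ (-1)^m x^(p+2m) / (2^m m! (2p+2m+1)!!)`. -/
def sphBessel (p : ℕ) (x : ℝ) : ℝ :=
  ∑' m : ℕ, (-1 : ℝ) ^ m * x ^ (p + 2 * m) /
    (2 ^ m * (Nat.factorial m : ℝ) * (Nat.doubleFactorial (2 * p + 2 * m + 1) : ℝ))

/-- `P` is a solid harmonic of degree `p`: a harmonic polynomial, homogeneous of degree `p`. The
real spherical harmonics of degree `p` are the restrictions of these to the unit sphere. -/
def IsSolidHarmonic (p : ℕ) (P : MvPolynomial (Fin 3) ℝ) : Prop :=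
  P.IsHomogeneous p ∧ ∑ i, MvPolynomial.pderiv i (MvPolynomial.pderiv i P) = 0

/-- The gradient of the polynomial `P` at `x`. -/
def polyGrad (P : MvPolynomial (Fin 3) ℝ) (x : E3) : E3 :=
  WithLp.toLp 2 fun i => MvPolynomial.eval (fun j => x j) (MvPolynomial.pderiv i P)

/-- The surface gradient at the point `ω` of the unit sphere of the restriction of `P`:
the tangential part of the gradient of `P`. -/
def surfaceGrad (P : MvPolynomial (Fin 3) ℝ) (w : E3) : E3 :=
  polyGrad P w - inner ℝ w (polyGrad P w) • w

/-- `U = ∇_S Y / √(p(p+1))`, with `Y` the restriction of `P` to the unit sphere. -/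
def fieldU (p : ℕ) (P : MvPolynomial (Fin 3) ℝ) (w : E3) : E3 :=
  (√((p : ℝ) * (p + 1)))⁻¹ • surfaceGrad P w

/-- `V = ω × U`. -/
def fieldV (p : ℕ) (P : MvPolynomial (Fin 3) ℝ) (w : E3) : E3 :=
  cross w (fieldU p P w)

/-- With `coeffD`, the solution of `C + D = -√(p(p+1))`, `C R^p + D R^(-p-1) = 0`. -/
def coeffC (p : ℕ) (R : ℝ) : ℝ :=
  √((p : ℝ) * (p + 1)) / (R ^ (2 * p + 1) - 1)

/-- See `coeffC`. -/
def coeffD (p : ℕ) (R : ℝ) : ℝ :=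
  -(√((p : ℝ) * (p + 1)) * R ^ (2 * p + 1) / (R ^ (2 * p + 1) - 1))

theorem coeffC_add_coeffD (p : ℕ) {R : ℝ} (hR : 1 < R) :
    coeffC p R + coeffD p R = -√((p : ℝ) * (p + 1)) := by
  have h : R ^ (2 * p + 1) - 1 ≠ 0 := (sub_pos.2 (one_lt_pow₀ hR (by omega))).ne'
  unfold coeffC coeffD
  field_simp
  ring

theorem coeff_boundary (p : ℕ) {R : ℝ} (hR : 1 < R) :
    coeffC p R * R ^ p + coeffD p R / R ^ (p + 1) = 0 := by
  have h : R ^ (2 * p + 1) - 1 ≠ 0 := (sub_pos.2 (one_lt_pow₀ hR (by omega))).ne'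
  have h0 : R ≠ 0 := by positivity
  unfold coeffC coeffD
  field_simp
  ring

/-- The separated field: for `x = r ω`, `r = |x|`,
`E(x) = -(j_p(k r) / j_p(k)) V(ω)` if `r ≤ 1`, and
`E(x) = (C r^p + D r^(-p-1)) V(ω) / √(p(p+1))` if `r > 1`. -/
def separatedField (p : ℕ) (P : MvPolynomial (Fin 3) ℝ) (R k : ℝ) (x : E3) : E3 :=
  if ‖x‖ ≤ 1 then
    (-(sphBessel p (k * ‖x‖) / sphBessel p k)) • fieldV p P (‖x‖⁻¹ • x)
  else
    ((coeffC p R * ‖x‖ ^ p + coeffD p R / ‖x‖ ^ (p + 1)) / √((p : ℝ) * (p + 1))) •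
      fieldV p P (‖x‖⁻¹ • x)

end MaxwellENZ

end

/-! The separated field has the form `g(|x|²) x × ∇P` with `P` the solid harmonic, and this class is
stable under the double curl: `curl curl` replaces `g` by `-(4 s g'' + (4p + 6) g')`, where `s =
|x|²` (`curl_torField`, `curl_polField`). The problem thus becomes a scalar equation: `4 s g'' + (4p
+ 6) g' = -k² g` for `s < 1`, and the same with right side `0` in the shell. Writing `j_p(x) = x^p
γ_p(x²)`, the first has the regular solution `γ_p(k² s)`, the second the solutions `C + D
s^(-(2p+1)/2)`; `C` and `D` are fixed by continuity at `s = 1` and by the boundary condition at `s =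
R²`.

What remains is continuity of `g'` at `s = 1`, which makes `curl E` continuous across the interface
as well. As `γ_p' = -γ_{p+1} / 2`, it reads `t γ_{p+1}(t) = M γ_p(t)` with `t = k²` and `M =
interfaceRatio p R`. This says that the derivative of `t^(M/2) γ_p(t)` vanishes, so Rolle's theorem
gives a solution between any two positive zeros of `γ_p`, and these zeros are unbounded
(`exists_besselAux_ratio`).

The weak formulation is reached without surface integrals. A glued field is its outer piece plus a
correction in the unit ball that vanishes on the sphere, and such a correction is an admissible test
field by a cut-off argument (`integral_ball_eq_of_isWeakCurl`). The resulting identity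
`integral_inner_glue_curl` is used twice: for `E`, to show that it lies in `H₀(curl)`, and for `curl
E` against an arbitrary `F`, to obtain the eigenvalue equation.

The field is not electrostatic because the radial component of `curl E` is a multiple of `g P` in
which `g` has no zero for `1 < r < R`; if it vanished, `P` would vanish on the shell and hence be
zero. -/

noncomputable section

namespace MaxwellENZ

/-! ### Partial derivatives of scalar functions -/

/-- `f` is differentiable at `x` and `∂ᵢ f (x) = d`. -/
def HasPartial (f : E3 → ℝ) (i : Fin 3) (x : E3) (d : ℝ) : Prop :=
  DifferentiableAt ℝ f x ∧ fderiv ℝ f x (EuclideanSpace.single i 1) = d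

namespace HasPartial

variable {f g : E3 → ℝ} {i : Fin 3} {x : E3} {d e : ℝ}

theorem mul (hf : HasPartial f i x d) (hg : HasPartial g i x e) :
    HasPartial (fun y => f y * g y) i x (d * g x + f x * e) := by
  refine ⟨hf.1.mul hg.1, ?_⟩
  have h := (hf.1.hasFDerivAt.mul hg.1.hasFDerivAt).fderiv
  rw [← hf.2, ← hg.2, show (fun y => f y * g y) = f * g from rfl, h]
  simp; ring

theorem add (hf : HasPartial f i x d) (hg : HasPartial g i x e) :
    HasPartial (fun y => f y + g y) i x (d + e) := by
  refine ⟨hf.1.add hg.1, ?_⟩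
  have h := (hf.1.hasFDerivAt.add hg.1.hasFDerivAt).fderiv
  rw [← hf.2, ← hg.2, show (fun y => f y + g y) = f + g from rfl, h]
  simp

theorem sub (hf : HasPartial f i x d) (hg : HasPartial g i x e) :
    HasPartial (fun y => f y - g y) i x (d - e) := by
  refine ⟨hf.1.sub hg.1, ?_⟩
  have h := (hf.1.hasFDerivAt.sub hg.1.hasFDerivAt).fderiv
  rw [← hf.2, ← hg.2, show (fun y => f y - g y) = f - g from rfl, h]
  simp

theorem const (c : ℝ) (i : Fin 3) (x : E3) : HasPartial (fun _ => c) i x 0 :=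
  ⟨differentiableAt_const c, by simp⟩

theorem const_mul (c : ℝ) (hf : HasPartial f i x d) :
    HasPartial (fun y => c * f y) i x (c * d) := by
  simpa using (const c i x).mul hf

theorem coord (j i : Fin 3) (x : E3) :
    HasPartial (fun y => y j) i x (if j = i then 1 else 0) := by
  have h : HasFDerivAt (fun y : E3 => y j) (EuclideanSpace.proj (𝕜 := ℝ) j) x :=
    (EuclideanSpace.proj (𝕜 := ℝ) j).hasFDerivAt
  refine ⟨h.differentiableAt, ?_⟩
  rw [h.fderiv]
  simp

theorem comp {h : ℝ → ℝ} {h' : ℝ} (hh : HasDerivAt h h' (f x)) (hf : HasPartial f i x d) :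
    HasPartial (fun y => h (f y)) i x (h' * d) := by
  have := hh.comp_hasFDerivAt x hf.1.hasFDerivAt
  refine ⟨this.differentiableAt, ?_⟩
  rw [show (fun y => h (f y)) = h ∘ f from rfl, this.fderiv, ← hf.2]
  simp

theorem normSq (i : Fin 3) (x : E3) : HasPartial (fun y => ‖y‖ ^ 2) i x (2 * x i) := by
  have h := (hasStrictFDerivAt_norm_sq (F := E3) x).hasFDerivAt
  refine ⟨h.differentiableAt, ?_⟩
  rw [h.fderiv]
  simp [EuclideanSpace.inner_single_right]

theorem eval (Q : MvPolynomial (Fin 3) ℝ) (i : Fin 3) (x : E3) :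
    HasPartial (fun y => MvPolynomial.eval (fun j => y j) Q) i x
      (MvPolynomial.eval (fun j => x j) (MvPolynomial.pderiv i Q)) := by
  induction Q using MvPolynomial.induction_on with
  | C a => simpa using const a i x
  | add p q hp hq => simpa using hp.add hq
  | mul_X p j hp =>
    have := hp.mul (coord j i x)
    simp only [map_mul, MvPolynomial.eval_X, Derivation.leibniz, MvPolynomial.pderiv_X, map_add,
      smul_eq_mul]
    convert this using 1
    by_cases h : j = i
    · subst h; simp; ring
    · simp [h]; ring

end HasPartial

theorem partialDeriv_eq {φ : E3 → E3} {i j : Fin 3} {x : E3} {d : ℝ}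
    (h : HasPartial (fun y => φ y j) i x d) : partialDeriv φ i j x = d := h.2

theorem DifferentiableAt.hasPartial {φ : E3 → E3} {x : E3} (h : DifferentiableAt ℝ φ x)
    (i j : Fin 3) : HasPartial (fun y => φ y j) i x (partialDeriv φ i j x) :=
  ⟨(EuclideanSpace.proj (𝕜 := ℝ) j).differentiableAt.comp x h, rfl⟩

theorem norm_sq_eq_sum (x : E3) : ‖x‖ ^ 2 = x 0 * x 0 + x 1 * x 1 + x 2 * x 2 := by
  rw [EuclideanSpace.norm_sq_eq]
  simp [Fin.sum_univ_three, sq]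

/-! ### Curl of smooth fields -/

theorem contDiff_eval (Q : MvPolynomial (Fin 3) ℝ) {n : WithTop ℕ∞} :
    ContDiff ℝ n (fun y : E3 => MvPolynomial.eval (fun j => y j) Q) := by
  induction Q using MvPolynomial.induction_on with
  | C a => simpa using contDiff_const
  | add p q hp hq => simpa using hp.add hq
  | mul_X p j hp => simpa using hp.mul (by fun_prop)

theorem contDiff_polyGrad (P : MvPolynomial (Fin 3) ℝ) {n : WithTop ℕ∞} :
    ContDiff ℝ n (polyGrad P) :=
  contDiff_euclidean.2 fun i => contDiff_eval (MvPolynomial.pderiv i P)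

theorem contDiff_vec3 {f g h : E3 → ℝ} {n : WithTop ℕ∞} (hf : ContDiff ℝ n f)
    (hg : ContDiff ℝ n g) (hh : ContDiff ℝ n h) :
    ContDiff ℝ n (fun x => (!₂[f x, g x, h x] : E3)) := by
  refine contDiff_euclidean.2 fun i => ?_
  fin_cases i <;> simpa

theorem contDiff_apply_coord {φ : E3 → E3} {n : WithTop ℕ∞} (h : ContDiff ℝ n φ) (j : Fin 3) :
    ContDiff ℝ n (fun y => φ y j) := contDiff_euclidean.1 h j

theorem ContDiff.cross {φ ψ : E3 → E3} {n : WithTop ℕ∞} (hφ : ContDiff ℝ n φ)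
    (hψ : ContDiff ℝ n ψ) : ContDiff ℝ n (fun x => cross (φ x) (ψ x)) := by
  have a := contDiff_apply_coord hφ
  have b := contDiff_apply_coord hψ
  exact contDiff_vec3 (((a 1).mul (b 2)).sub ((a 2).mul (b 1)))
    (((a 2).mul (b 0)).sub ((a 0).mul (b 2))) (((a 0).mul (b 1)).sub ((a 1).mul (b 0)))

theorem contDiff_partialDeriv {φ : E3 → E3} (h : ContDiff ℝ ∞ φ) (i j : Fin 3) :
    ContDiff ℝ ∞ (partialDeriv φ i j) :=
  ((contDiff_apply_coord h j).fderiv_right (m := ∞) (by simp)).clm_apply contDiff_const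

theorem contDiff_curl {φ : E3 → E3} (h : ContDiff ℝ ∞ φ) : ContDiff ℝ ∞ (curl φ) := by
  have a := contDiff_partialDeriv h
  exact contDiff_vec3 ((a 1 2).sub (a 2 1)) ((a 2 0).sub (a 0 2)) ((a 0 1).sub (a 1 0))

theorem curl_congr {φ ψ : E3 → E3} {x : E3} (h : φ =ᶠ[nhds x] ψ) : curl φ x = curl ψ x := by
  have : ∀ i j, partialDeriv φ i j x = partialDeriv ψ i j x := fun i j => by
    unfold partialDeriv
    have hj : (fun y => φ y j) =ᶠ[nhds x] fun y => ψ y j := h.mono fun y hy => by simp only [hy]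
    rw [hj.fderiv_eq]
  simp only [curl, this]

theorem curl_zero (x : E3) : curl (fun _ => 0) x = 0 := by
  ext i; fin_cases i <;> simp [curl, partialDeriv]

theorem curl_sub {φ ψ : E3 → E3} {x : E3} (hφ : DifferentiableAt ℝ φ x)
    (hψ : DifferentiableAt ℝ ψ x) : curl (fun y => φ y - ψ y) x = curl φ x - curl ψ x := by
  have : ∀ i j, partialDeriv (fun y => φ y - ψ y) i j x =
      partialDeriv φ i j x - partialDeriv ψ i j x := fun i j =>
    partialDeriv_eq ((DifferentiableAt.hasPartial hφ i j).sub (DifferentiableAt.hasPartial hψ i j))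
  ext i; fin_cases i <;> simp [curl, this] <;> ring

/-- `curl (h(|x|²) φ) = h(|x|²) curl φ + 2 h'(|x|²) x × φ`. -/
theorem curl_radial_smul {h : ℝ → ℝ} {h' : ℝ} {φ : E3 → E3} {x : E3}
    (hh : HasDerivAt h h' (‖x‖ ^ 2)) (hφ : DifferentiableAt ℝ φ x) :
    curl (fun y => h (‖y‖ ^ 2) • φ y) x =
      h (‖x‖ ^ 2) • curl φ x + (2 * h') • cross x (φ x) := by
  have : ∀ i j, partialDeriv (fun y => h (‖y‖ ^ 2) • φ y) i j x =
      h' * (2 * x i) * φ x j + h (‖x‖ ^ 2) * partialDeriv φ i j x := fun i j =>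
    partialDeriv_eq ((HasPartial.comp hh (HasPartial.normSq i x)).mul
      (DifferentiableAt.hasPartial hφ i j))
  ext i; fin_cases i <;> simp [curl, this, cross] <;> ring

/-! ### Separated fields -/

/-- The field `g(|x|²) x × ∇P`. -/
def torField (P : MvPolynomial (Fin 3) ℝ) (g : ℝ → ℝ) (x : E3) : E3 :=
  g (‖x‖ ^ 2) • cross x (polyGrad P x)

/-- The curl of `torField P g` if `g₁` is the derivative of `g`. -/
def polField (p : ℕ) (P : MvPolynomial (Fin 3) ℝ) (g g₁ : ℝ → ℝ) (x : E3) : E3 :=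
  (2 * g₁ (‖x‖ ^ 2)) • ((p * MvPolynomial.eval (fun j => x j) P) • x - ‖x‖ ^ 2 • polyGrad P x) -
    ((p + 1) * g (‖x‖ ^ 2)) • polyGrad P x

theorem contDiff_torField (P : MvPolynomial (Fin 3) ℝ) {g : ℝ → ℝ} (hg : ContDiff ℝ ∞ g) :
    ContDiff ℝ ∞ (torField P g) :=
  (hg.comp (contDiff_norm_sq ℝ)).smul (ContDiff.cross contDiff_id (contDiff_polyGrad P))

theorem contDiff_polField (p : ℕ) (P : MvPolynomial (Fin 3) ℝ) {g g₁ : ℝ → ℝ}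
    (hg : ContDiff ℝ ∞ g) (hg₁ : ContDiff ℝ ∞ g₁) : ContDiff ℝ ∞ (polField p P g g₁) := by
  have hn : ContDiff ℝ ∞ (fun x : E3 => ‖x‖ ^ 2) := contDiff_norm_sq ℝ
  have a := contDiff_polyGrad P (n := ∞)
  have b := contDiff_eval P (n := ∞)
  have c := hg.comp hn
  have d := hg₁.comp hn
  exact ((contDiff_const.mul d).smul (((contDiff_const.mul b).smul contDiff_id).sub
    (hn.smul a))).sub ((contDiff_const.mul c).smul a)

variable {p : ℕ} {P : MvPolynomial (Fin 3) ℝ}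

theorem euler_identity (hP : P.IsHomogeneous p) (x : E3) :
    ∑ i, x i * MvPolynomial.eval (fun j => x j) (MvPolynomial.pderiv i P) =
      p * MvPolynomial.eval (fun j => x j) P := by
  have := congrArg (MvPolynomial.eval (fun j => x j)) hP.sum_X_mul_pderiv
  simpa using this

/-- The commutator of two derivations is a derivation, and this one kills the variables. -/
theorem pderiv_comm (Q : MvPolynomial (Fin 3) ℝ) (i j : Fin 3) :
    MvPolynomial.pderiv i (MvPolynomial.pderiv j Q) =
      MvPolynomial.pderiv j (MvPolynomial.pderiv i Q) := by
  have h : ⁅MvPolynomial.pderiv (R := ℝ) i, MvPolynomial.pderiv (R := ℝ) j⁆ = 0 := by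
    refine MvPolynomial.derivation_ext fun k => ?_
    simp [Derivation.commutator_apply, Pi.single_apply, apply_ite]
  have := congrArg (fun D : Derivation ℝ (MvPolynomial (Fin 3) ℝ) (MvPolynomial (Fin 3) ℝ) => D Q) h
  simpa [Derivation.commutator_apply, sub_eq_zero] using this

/-- Obtained by differentiating Euler's identity; the factor `p - 1` is a real number, so `p = 0` is
not exceptional. -/
theorem euler_identity_pderiv (hP : P.IsHomogeneous p) (x : E3) (k : Fin 3) :
    ∑ i, x i * MvPolynomial.eval (fun j => x j) (MvPolynomial.pderiv i (MvPolynomial.pderiv k P)) =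
      (p - 1) * MvPolynomial.eval (fun j => x j) (MvPolynomial.pderiv k P) := by
  have h := congrArg (MvPolynomial.pderiv k) hP.sum_X_mul_pderiv
  have := congrArg (MvPolynomial.eval (fun j => x j)) h
  simp only [map_sum, Derivation.leibniz, MvPolynomial.pderiv_X, map_add, smul_eq_mul, map_mul,
    MvPolynomial.eval_X, nsmul_eq_mul, Finset.sum_add_distrib] at this
  simp only [Pi.single_apply, apply_ite, map_one, map_zero, mul_one, mul_zero,
    Finset.sum_ite_eq', Finset.mem_univ, if_true, pderiv_comm P k] at this
  simp only [map_natCast, Derivation.map_natCast, map_zero, mul_zero, add_zero] at this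
  linarith

theorem laplace_eq (hP : IsSolidHarmonic p P) (x : E3) :
    ∑ i, MvPolynomial.eval (fun j => x j) (MvPolynomial.pderiv i (MvPolynomial.pderiv i P)) = 0 := by
  simpa using congrArg (MvPolynomial.eval (fun j => x j)) hP.2

/-- For `F = ∇P`, `curl (x × F) = x div F - 3 F + F - (x · ∇) F`; here `div F = 0` by harmonicity
and `(x · ∇) F = (p - 1) F` by homogeneity. -/
theorem curl_cross_polyGrad (hP : IsSolidHarmonic p P) (x : E3) :
    curl (fun y => cross y (polyGrad P y)) x = -((p + 1 : ℝ)) • polyGrad P x := by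
  have q := fun j i => HasPartial.eval (MvPolynomial.pderiv j P) i x
  have c := fun j i => HasPartial.coord j i x
  have h0 := fun i => partialDeriv_eq (φ := fun y => cross y (polyGrad P y)) (j := 0)
    (((c 1 i).mul (q 2 i)).sub ((c 2 i).mul (q 1 i)))
  have h1 := fun i => partialDeriv_eq (φ := fun y => cross y (polyGrad P y)) (j := 1)
    (((c 2 i).mul (q 0 i)).sub ((c 0 i).mul (q 2 i)))
  have h2 := fun i => partialDeriv_eq (φ := fun y => cross y (polyGrad P y)) (j := 2)
    (((c 0 i).mul (q 1 i)).sub ((c 1 i).mul (q 0 i)))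
  have hl := laplace_eq hP x
  have he := euler_identity_pderiv hP.1 x
  simp only [Fin.sum_univ_three] at hl he
  have he0 := he 0
  have he1 := he 1
  have he2 := he 2
  simp only [pderiv_comm P 1 0, pderiv_comm P 2 0, pderiv_comm P 2 1] at he0 he1 he2
  ext i; fin_cases i
  · simp [curl, h0, h1, h2]
    simp [polyGrad, pderiv_comm P 1 0, pderiv_comm P 2 0]
    linear_combination x 0 * hl - he0
  · simp [curl, h0, h1, h2]
    simp [polyGrad, pderiv_comm P 2 1]
    linear_combination x 1 * hl - he1
  · simp [curl, h0, h1, h2]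
    simp [polyGrad]
    linear_combination x 2 * hl - he2

/-- The derivative of the radial factor contributes `x × (x × ∇P) = (x · ∇P) x - |x|² ∇P`, where `x
· ∇P = p P` by Euler. -/
theorem curl_torField (hP : IsSolidHarmonic p P) {g g₁ : ℝ → ℝ} {x : E3}
    (hg : HasDerivAt g (g₁ (‖x‖ ^ 2)) (‖x‖ ^ 2)) :
    curl (torField P g) x = polField p P g g₁ x := by
  have hW : DifferentiableAt ℝ (fun y => cross y (polyGrad P y)) x :=
    (ContDiff.cross contDiff_id (contDiff_polyGrad P (n := 1))).differentiable (by simp) x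
  have he := euler_identity hP.1 x
  have hn := norm_sq_eq_sum x
  simp only [Fin.sum_univ_three] at he
  unfold torField
  rw [curl_radial_smul hg hW, curl_cross_polyGrad hP]
  unfold polField
  generalize g₁ (‖x‖ ^ 2) = a
  generalize g (‖x‖ ^ 2) = b
  rw [hn]
  ext i; fin_cases i
  · simp [cross, polyGrad]
    linear_combination 2 * a * x 0 * he
  · simp [cross, polyGrad]
    linear_combination 2 * a * x 1 * he
  · simp [cross, polyGrad]
    linear_combination 2 * a * x 2 * he

/-- Both `x` and `∇P` are curl free, so only the gradients of the scalar coefficients contribute,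
and each contribution is a multiple of `x × ∇P`. Harmonicity and homogeneity play no role here. -/
theorem curl_polField (P : MvPolynomial (Fin 3) ℝ) {g g₁ : ℝ → ℝ} {g₂ : ℝ} {x : E3}
    (hg : HasDerivAt g (g₁ (‖x‖ ^ 2)) (‖x‖ ^ 2)) (hg₁ : HasDerivAt g₁ g₂ (‖x‖ ^ 2)) :
    curl (polField p P g g₁) x =
      -(4 * ‖x‖ ^ 2 * g₂ + (4 * p + 6) * g₁ (‖x‖ ^ 2)) • cross x (polyGrad P x) := by
  have q := fun j i => HasPartial.eval (MvPolynomial.pderiv j P) i x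
  have e := fun i => HasPartial.eval P i x
  have c := fun j i => HasPartial.coord j i x
  have n := fun i => HasPartial.normSq i x
  have a := fun i => HasPartial.comp hg (n i)
  have b := fun i => HasPartial.comp hg₁ (n i)
  have h := fun i j => partialDeriv_eq (φ := polField p P g g₁) (j := j)
    ((((b i).const_mul 2).mul ((((e i).const_mul p).mul (c j i)).sub ((n i).mul (q j i)))).sub
      (((a i).const_mul (p + 1)).mul (q j i)))
  ext i; fin_cases i
  all_goals
    simp [curl, h]
    simp [polyGrad, cross, pderiv_comm P 1 0, pderiv_comm P 2 0, pderiv_comm P 2 1]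
    ring

/-- The term with `g₁` is tangential to spheres by Euler's identity, so the radial component sees
`g` alone. -/
theorem inner_polField (hP : IsSolidHarmonic p P) (g g₁ : ℝ → ℝ) (x : E3) :
    inner ℝ (polField p P g g₁ x) x =
      -(p * (p + 1) * g (‖x‖ ^ 2) * MvPolynomial.eval (fun j => x j) P) := by
  have he := euler_identity hP.1 x
  have hn := norm_sq_eq_sum x
  simp only [Fin.sum_univ_three] at he
  unfold polField
  generalize g₁ (‖x‖ ^ 2) = a
  generalize g (‖x‖ ^ 2) = b
  rw [hn]
  simp [PiLp.inner_apply, Fin.sum_univ_three, polyGrad]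
  linear_combination (-(2 * a * (x 0 * x 0 + x 1 * x 1 + x 2 * x 2)) - (p + 1) * b) * he

/-! ### The entire function `γ_p` with `j_p(x) = x^p γ_p(x²)` -/

/-- The coefficients of `besselAux`. -/
def besselCoeff (p m : ℕ) : ℝ :=
  (-1) ^ m / (2 ^ m * (Nat.factorial m : ℝ) * (Nat.doubleFactorial (2 * p + 2 * m + 1) : ℝ))

/-- The entire function `γ_p` with `j_p(x) = x^p γ_p(x²)`. -/
def besselAux (p : ℕ) (t : ℝ) : ℝ := ∑' m : ℕ, besselCoeff p m * t ^ m

/-- The relation `γ_p' = -γ_{p+1} / 2` on the level of coefficients. -/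
theorem besselCoeff_succ (p m : ℕ) :
    (m + 1) * besselCoeff p (m + 1) = -(1 / 2) * besselCoeff (p + 1) m := by
  unfold besselCoeff
  rw [show 2 * p + 2 * (m + 1) + 1 = 2 * (p + 1) + 2 * m + 1 by ring, Nat.factorial_succ]
  have h1 : (Nat.factorial m : ℝ) ≠ 0 := by positivity
  have h2 : (Nat.doubleFactorial (2 * (p + 1) + 2 * m + 1) : ℝ) ≠ 0 := by
    exact_mod_cast (Nat.doubleFactorial_pos _).ne'
  push_cast
  field_simp
  ring

theorem besselCoeff_succ_left (p m : ℕ) :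
    (2 * p + 3 + 2 * m) * besselCoeff (p + 1) m = besselCoeff p m := by
  unfold besselCoeff
  rw [show 2 * (p + 1) + 2 * m + 1 = (2 * p + 2 * m + 1) + 2 by ring, Nat.doubleFactorial_add_two]
  have h1 : (Nat.factorial m : ℝ) ≠ 0 := by positivity
  have h2 : (Nat.doubleFactorial (2 * p + 2 * m + 1) : ℝ) ≠ 0 := by
    exact_mod_cast (Nat.doubleFactorial_pos _).ne'
  push_cast
  field_simp
  ring

theorem abs_besselCoeff_le (p m : ℕ) : |besselCoeff p m| ≤ 1 / (Nat.factorial m : ℝ) := by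
  unfold besselCoeff
  have h1 : (1 : ℝ) ≤ Nat.factorial m := by exact_mod_cast Nat.factorial_pos m
  have h2 : (1 : ℝ) ≤ (Nat.doubleFactorial (2 * p + 2 * m + 1) : ℝ) := by
    exact_mod_cast Nat.doubleFactorial_pos _
  have h3 : (1 : ℝ) ≤ 2 ^ m := one_le_pow₀ (by norm_num)
  rw [abs_div, abs_pow, abs_neg, abs_one, one_pow, abs_of_pos (by positivity)]
  gcongr
  calc (Nat.factorial m : ℝ) = 1 * Nat.factorial m * 1 := by ring
    _ ≤ _ := by gcongr

theorem hasSum_besselAux (p : ℕ) (t : ℝ) :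
    HasSum (fun m => besselCoeff p m * t ^ m) (besselAux p t) := by
  refine Summable.hasSum (Summable.of_norm_bounded (Real.summable_pow_div_factorial |t|) fun m => ?_)
  rw [Real.norm_eq_abs, abs_mul, abs_pow]
  calc _ ≤ 1 / (Nat.factorial m : ℝ) * |t| ^ m := by gcongr; exact abs_besselCoeff_le p m
    _ = _ := by ring

theorem sphBessel_eq (p : ℕ) (x : ℝ) : sphBessel p x = x ^ p * besselAux p (x ^ 2) := by
  unfold sphBessel besselAux
  rw [← tsum_mul_left]
  refine tsum_congr fun m => ?_
  unfold besselCoeff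
  rw [pow_add, pow_mul]
  ring

theorem hasSum_deriv_besselAux (p : ℕ) (t : ℝ) :
    HasSum (fun m : ℕ => besselCoeff p m * (m * t ^ (m - 1))) (-(1 / 2) * besselAux (p + 1) t) := by
  rw [← hasSum_nat_add_iff' 1]
  simp only [Finset.range_one, Finset.sum_singleton, Nat.cast_zero, zero_mul, mul_zero, sub_zero,
    Nat.add_sub_cancel]
  refine ((hasSum_besselAux (p + 1) t).mul_left (-(1 / 2))).congr_fun fun m => ?_
  have := besselCoeff_succ p m
  push_cast
  linear_combination t ^ m * this

theorem hasDerivAt_besselAux (p : ℕ) (t : ℝ) :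
    HasDerivAt (besselAux p) (-(1 / 2) * besselAux (p + 1) t) t := by
  set r := |t| + 1
  have hr : t ∈ Metric.ball (0 : ℝ) r := by simp [r]
  have hsum : Summable fun m : ℕ => (m : ℝ) * r ^ (m - 1) / (Nat.factorial m : ℝ) := by
    rw [← summable_nat_add_iff 1]
    refine (Real.summable_pow_div_factorial r).congr fun m => ?_
    rw [Nat.factorial_succ, Nat.add_sub_cancel]
    have h1 : (Nat.factorial m : ℝ) ≠ 0 := by positivity
    push_cast
    field_simp
  have h := hasDerivAt_tsum_of_isPreconnected (g := fun m s => besselCoeff p m * s ^ m)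
    (g' := fun m s => besselCoeff p m * (m * s ^ (m - 1))) hsum Metric.isOpen_ball
    (convex_ball (0 : ℝ) r).isPreconnected
    (fun m s _ => (hasDerivAt_pow m s).const_mul _) (fun m s hs => ?_) hr
    (hasSum_besselAux p t).summable hr
  · rwa [(hasSum_deriv_besselAux p t).tsum_eq] at h
  · have hs' : |s| ≤ r := by simpa using (mem_ball_zero_iff.1 hs).le
    rw [Real.norm_eq_abs, abs_mul, abs_mul, abs_pow, Nat.abs_cast]
    calc _ ≤ 1 / (Nat.factorial m : ℝ) * (m * r ^ (m - 1)) := by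
          gcongr; exact abs_besselCoeff_le p m
      _ = _ := by ring

/-- Multiplying the `m`-th coefficient by `2p + 3 + 2m` is the operator `2p + 3 + 2 t d/dt`, which
therefore maps `γ_{p+1}` to `γ_p`. Together with `γ_p' = -γ_{p+1} / 2` this is Bessel's equation. -/
theorem besselAux_recurrence (p : ℕ) (t : ℝ) :
    (2 * p + 3) * besselAux (p + 1) t - t * besselAux (p + 2) t = besselAux p t := by
  have h := ((hasSum_besselAux (p + 1) t).mul_left (2 * p + 3 : ℝ)).add
    ((hasSum_deriv_besselAux (p + 1) t).mul_left (2 * t))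
  have h' : HasSum (fun m => besselCoeff p m * t ^ m) _ := h.congr_fun fun m => by
    rw [← besselCoeff_succ_left]
    cases m with
    | zero => simp
    | succ m => rw [Nat.add_sub_cancel, pow_succ]; push_cast; ring
  rw [(hasSum_besselAux p t).unique h']
  ring

theorem sin_eq_besselAux (x : ℝ) : Real.sin x = x * besselAux 0 (x ^ 2) := by
  refine (Real.hasSum_sin x).unique (((hasSum_besselAux 0 (x ^ 2)).mul_left x).congr_fun fun m => ?_)
  unfold besselCoeff
  rw [Nat.factorial_eq_mul_doubleFactorial, Nat.doubleFactorial_two_mul]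
  push_cast
  ring_nf

theorem contDiff_besselAux (p : ℕ) : ContDiff ℝ ∞ (besselAux p) := by
  refine contDiff_infty.2 fun n => ?_
  induction n generalizing p with
  | zero =>
    exact contDiff_zero.2 (continuous_iff_continuousAt.2 fun t =>
      (hasDerivAt_besselAux p t).continuousAt)
  | succ n ih =>
    have hd : deriv (besselAux p) = fun t => -(1 / 2) * besselAux (p + 1) t :=
      funext fun t => (hasDerivAt_besselAux p t).deriv
    have := (contDiff_succ_iff_deriv (n := n) (f := besselAux p)).2
      ⟨fun t => (hasDerivAt_besselAux p t).differentiableAt, by simp, by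
        rw [hd]; exact contDiff_const.mul (ih (p + 1))⟩
    exact_mod_cast this

/-! ### Zeros of `γ_p` and the interface equation -/

theorem besselAux_zeros_unbounded (p : ℕ) (T : ℝ) : ∃ t, T < t ∧ besselAux p t = 0 := by
  induction p generalizing T with
  | zero =>
    obtain ⟨n, hn⟩ := exists_nat_gt (max T 1)
    have h1 : (1 : ℝ) < n := (le_max_right _ _).trans_lt hn
    refine ⟨(n * Real.pi) ^ 2, ((le_max_left _ _).trans_lt hn).trans ?_, ?_⟩
    · have h2 : (n : ℝ) < n * Real.pi := by nlinarith [Real.pi_gt_three]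
      exact h2.trans (lt_self_pow₀ (h1.trans h2) (by norm_num))
    · have := sin_eq_besselAux (n * Real.pi)
      rw [Real.sin_nat_mul_pi] at this
      have h0 : (n : ℝ) * Real.pi ≠ 0 := by positivity
      simpa [h0] using this.symm
  | succ p ih =>
    -- Rolle between two zeros of `γ_p` gives a zero of `γ_p'`, hence of `γ_{p+1}`.
    obtain ⟨a, ha, ha0⟩ := ih T
    obtain ⟨b, hb, hb0⟩ := ih a
    obtain ⟨c, hc, hc0⟩ := exists_hasDerivAt_eq_zero (f := besselAux p) hb
      (contDiff_besselAux p).continuous.continuousOn (ha0.trans hb0.symm)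
      (fun t _ => hasDerivAt_besselAux p t)
    exact ⟨c, ha.trans hc.1, by linarith⟩

/-- The recurrence carries a common zero down to `p = 0`, where it would be a common zero of sine
and cosine. -/
theorem besselAux_no_common_zero (p : ℕ) {t : ℝ} (ht : 0 < t) (h0 : besselAux p t = 0) :
    besselAux (p + 1) t ≠ 0 := by
  intro h1
  induction p with
  | zero =>
    have hs : √t ^ 2 = t := Real.sq_sqrt ht.le
    have hsin : Real.sin √t = 0 := by rw [sin_eq_besselAux, hs, h0, mul_zero]
    have hd : HasDerivAt (fun x => x * besselAux 0 (x ^ 2)) 0 √t := by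
      have ha := hasDerivAt_besselAux 0 (√t ^ 2)
      have := (hasDerivAt_id √t).mul (HasDerivAt.comp (h := fun x : ℝ => x ^ 2) √t ha (hasDerivAt_pow 2 √t))
      refine HasDerivAt.congr_deriv this ?_
      simp [hs, h0, h1]
    rw [← funext sin_eq_besselAux] at hd
    have hcos : Real.cos √t = 0 := (Real.hasDerivAt_sin _).unique hd
    have := Real.sin_sq_add_cos_sq √t
    simp [hsin, hcos] at this
  | succ p ih =>
    refine ih ?_ h0
    rw [← besselAux_recurrence, h0, h1]
    ring

/-- The interface condition `t γ_{p+1}(t) = M γ_p(t)` has arbitrarily large solutions. -/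
theorem exists_besselAux_ratio (p : ℕ) (M T : ℝ) :
    ∃ t, T < t ∧ besselAux p t ≠ 0 ∧ t * besselAux (p + 1) t = M * besselAux p t := by
  -- The bound `0` keeps the interval where `t^(M/2)` is differentiable.
  obtain ⟨a, ha, ha0⟩ := besselAux_zeros_unbounded p (max T 0)
  obtain ⟨b, hb, hb0⟩ := besselAux_zeros_unbounded p a
  have hapos : 0 < a := (le_max_right _ _).trans_lt ha
  -- The factor `t^(M/2)` is an integrating factor: the derivative of the product is `t^(M/2 - 1) (M
  -- γ_p - t γ_{p+1}) / 2`.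
  have hcont : ContinuousOn (fun t : ℝ => t ^ (M / 2) * besselAux p t) (Set.Icc a b) :=
    ContinuousOn.mul (fun t ht => (Real.continuousAt_rpow_const t _
      (Or.inl (hapos.trans_le ht.1).ne')).continuousWithinAt)
      (contDiff_besselAux p).continuous.continuousOn
  obtain ⟨c, hc, hc0⟩ := exists_hasDerivAt_eq_zero hb hcont (by simp [ha0, hb0])
    (fun t ht => (Real.hasDerivAt_rpow_const (p := M / 2)
      (Or.inl (hapos.trans ht.1).ne')).mul (hasDerivAt_besselAux p t))
  have hcpos : 0 < c := hapos.trans hc.1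
  have hpow : c ^ (M / 2) = c ^ (M / 2 - 1) * c := by
    rw [← Real.rpow_add_one hcpos.ne']; ring_nf
  have hne : c ^ (M / 2 - 1) ≠ 0 := (Real.rpow_pos_of_pos hcpos _).ne'
  have heq : c * besselAux (p + 1) c = M * besselAux p c := by
    rw [hpow] at hc0
    refine mul_left_cancel₀ hne ?_
    linear_combination -2 * hc0
  refine ⟨c, ((le_max_left _ _).trans_lt ha).trans hc.1, fun h => ?_, heq⟩
  refine besselAux_no_common_zero p hcpos h ?_
  simpa [h, hcpos.ne'] using heq

/-! ### Weak curls and fields glued along a sphere -/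

theorem norm_cross_le (x y : E3) : ‖cross x y‖ ≤ ‖x‖ * ‖y‖ := by
  refine le_of_sq_le_sq ?_ (by positivity)
  rw [mul_pow, norm_sq_eq_sum, norm_sq_eq_sum, norm_sq_eq_sum]
  have : cross x y 0 = x 1 * y 2 - x 2 * y 1 ∧ cross x y 1 = x 2 * y 0 - x 0 * y 2 ∧
      cross x y 2 = x 0 * y 1 - x 1 * y 0 := ⟨rfl, rfl, rfl⟩
  rw [this.1, this.2.1, this.2.2]
  -- Lagrange's identity: the two sides differ by `(x · y)²`.
  nlinarith [sq_nonneg (x 0 * y 0 + x 1 * y 1 + x 2 * y 2)]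

theorem inner_eq_sum (x y : E3) : inner ℝ x y = x 0 * y 0 + x 1 * y 1 + x 2 * y 2 := by
  simp [PiLp.inner_apply, Fin.sum_univ_three, mul_comm]

theorem tsupport_curl_subset (φ : E3 → E3) : tsupport (curl φ) ⊆ tsupport φ := by
  refine closure_minimal (fun x hx => ?_) (isClosed_tsupport φ)
  by_contra h
  refine hx ?_
  rw [curl_congr (notMem_tsupport_iff_eventuallyEq.1 h)]
  exact curl_zero x

theorem integral_partialDeriv_mul {φ ψ : E3 → E3} (hφ : ContDiff ℝ ∞ φ) (hψ : ContDiff ℝ ∞ ψ)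
    (hc : HasCompactSupport ψ) (i j k : Fin 3) :
    Integrable (fun x => partialDeriv φ i j x * ψ x k) ∧
    Integrable (fun x => φ x j * partialDeriv ψ i k x) ∧
    ∫ x, partialDeriv φ i j x * ψ x k = -∫ x, φ x j * partialDeriv ψ i k x := by
  have hφj := contDiff_apply_coord hφ j
  have hψk := contDiff_apply_coord hψ k
  have hck : HasCompactSupport (fun x => ψ x k) :=
    hc.comp_left (g := fun y : E3 => y k) rfl
  have hcd : HasCompactSupport (partialDeriv ψ i k) :=
    (hck.fderiv (𝕜 := ℝ)).comp_left (g := fun L : E3 →L[ℝ] ℝ => L (EuclideanSpace.single i 1)) rfl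
  have h1 : Integrable (fun x => partialDeriv φ i j x * ψ x k) :=
    ((contDiff_partialDeriv hφ i j).continuous.mul hψk.continuous).integrable_of_hasCompactSupport
      hck.mul_left
  have h2 : Integrable (fun x => φ x j * partialDeriv ψ i k x) :=
    (hφj.continuous.mul (contDiff_partialDeriv hψ i k).continuous).integrable_of_hasCompactSupport
      hcd.mul_left
  have h3 : Integrable (fun x => φ x j * ψ x k) :=
    (hφj.continuous.mul hψk.continuous).integrable_of_hasCompactSupport hck.mul_left
  refine ⟨h1, h2, ?_⟩
  have := integral_mul_fderiv_eq_neg_fderiv_mul_of_integrable (𝕜 := ℝ) (μ := volume) h1 h2 h3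
    (fun x _ => hφj.differentiable (by simp) x) (fun x _ => hψk.differentiable (by simp) x)
  unfold partialDeriv
  rw [this, neg_neg]

theorem integral_sub_add_sub {a b c d e f : E3 → ℝ} (ha : Integrable a) (hb : Integrable b)
    (hc : Integrable c) (hd : Integrable d) (he : Integrable e) (hf : Integrable f) :
    ∫ x, ((a x - b x) + (c x - d x) + (e x - f x)) =
      ((∫ x, a x) - ∫ x, b x) + ((∫ x, c x) - ∫ x, d x) + ((∫ x, e x) - ∫ x, f x) := by
  have h1 : Integrable fun x => a x - b x := ha.sub hb
  have h2 : Integrable fun x => c x - d x := hc.sub hd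
  have h3 : Integrable fun x => e x - f x := he.sub hf
  have h4 : Integrable fun x => (a x - b x) + (c x - d x) := h1.add h2
  rw [integral_add h4 h3, integral_add h1 h2, integral_sub ha hb, integral_sub hc hd,
    integral_sub he hf]

theorem integral_curl_inner {φ ψ : E3 → E3} (hφ : ContDiff ℝ ∞ φ) (hψ : ContDiff ℝ ∞ ψ)
    (hc : HasCompactSupport ψ) :
    ∫ x, inner ℝ (curl φ x) (ψ x) = ∫ x, inner ℝ (φ x) (curl ψ x) := by
  have h := integral_partialDeriv_mul hφ hψ hc
  have hI := fun i j k => (h i j k).1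
  have hJ := fun i j k => (h i j k).2.1
  have e1 : ∀ x, inner ℝ (curl φ x) (ψ x) =
      (partialDeriv φ 1 2 x * ψ x 0 - partialDeriv φ 2 1 x * ψ x 0) +
      (partialDeriv φ 2 0 x * ψ x 1 - partialDeriv φ 0 2 x * ψ x 1) +
      (partialDeriv φ 0 1 x * ψ x 2 - partialDeriv φ 1 0 x * ψ x 2) := fun x => by
    rw [inner_eq_sum]; simp [curl]; ring
  have e2 : ∀ x, inner ℝ (φ x) (curl ψ x) =
      (φ x 0 * partialDeriv ψ 1 2 x - φ x 0 * partialDeriv ψ 2 1 x) +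
      (φ x 1 * partialDeriv ψ 2 0 x - φ x 1 * partialDeriv ψ 0 2 x) +
      (φ x 2 * partialDeriv ψ 0 1 x - φ x 2 * partialDeriv ψ 1 0 x) := fun x => by
    rw [inner_eq_sum]; simp [curl]; ring
  simp only [e1, e2]
  rw [integral_sub_add_sub (hI 1 2 0) (hI 2 1 0) (hI 2 0 1) (hI 0 2 1) (hI 0 1 2) (hI 1 0 2),
    integral_sub_add_sub (hJ 1 0 2) (hJ 2 0 1) (hJ 2 1 0) (hJ 0 1 2) (hJ 0 2 1) (hJ 1 2 0)]
  simp only [(h _ _ _).2.2]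
  ring

theorem isWeakCurl_curl {φ : E3 → E3} (hφ : ContDiff ℝ ∞ φ) (Ω : Set E3) :
    IsWeakCurl Ω φ (curl φ) := by
  intro ψ hψ hc hs
  rw [setIntegral_eq_integral_of_forall_compl_eq_zero,
    setIntegral_eq_integral_of_forall_compl_eq_zero, integral_curl_inner hφ hψ hc]
  · intro x hx
    rw [image_eq_zero_of_notMem_tsupport fun h => hx (hs (tsupport_curl_subset ψ h)),
      inner_zero_right]
  · intro x hx
    rw [image_eq_zero_of_notMem_tsupport fun h => hx (hs h), inner_zero_right]

/-! ### Cutting off a field that vanishes on a sphere -/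

theorem exists_norm_le_mul_of_sphere_eq_zero {A : E3 → E3} (hA : ContDiff ℝ ∞ A) {ρ : ℝ}
    (hρ : 0 < ρ) (hA0 : ∀ x, ‖x‖ = ρ → A x = 0) :
    ∃ L, 0 ≤ L ∧ ∀ x, ‖x‖ ≤ ρ → ‖A x‖ ≤ L * (ρ - ‖x‖) := by
  obtain ⟨L, hL⟩ := (isCompact_closedBall (0 : E3) ρ).exists_bound_of_continuousOn
    (hA.continuous_fderiv (by simp)).continuousOn
  have hL0 : 0 ≤ L := (norm_nonneg _).trans (hL 0 (by simp [hρ.le]))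
  refine ⟨L, hL0, fun x hx => ?_⟩
  -- `y` is a nearest point of the sphere; the mean value inequality on the segment from `y` to `x`
  -- then gives the bound.
  obtain ⟨y, hy, hxy⟩ : ∃ y : E3, ‖y‖ = ρ ∧ ‖x - y‖ = ρ - ‖x‖ := by
    by_cases h0 : x = 0
    · exact ⟨EuclideanSpace.single 0 ρ, by simp [hρ.le], by simp [h0, hρ.le]⟩
    · have hx0 : 0 < ‖x‖ := norm_pos_iff.2 h0
      refine ⟨(ρ / ‖x‖) • x, ?_, ?_⟩
      · rw [norm_smul, Real.norm_of_nonneg (by positivity)]; field_simp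
      · have : x - (ρ / ‖x‖) • x = -((ρ / ‖x‖ - 1) • x) := by rw [sub_smul, one_smul]; abel
        rw [this, norm_neg, norm_smul, Real.norm_of_nonneg (by
          rw [sub_nonneg, le_div_iff₀ hx0]; simpa)]
        field_simp
  have := (convex_closedBall (0 : E3) ρ).norm_image_sub_le_of_norm_fderiv_le
    (fun z _ => hA.differentiable (by simp) z) hL (x := y) (y := x) (by simp [hy]) (by simpa)
  rwa [hA0 y hy, sub_zero, hxy] at this

theorem smoothTransition_deriv_eq_zero {u : ℝ} (hu : u ∉ Set.Icc (0 : ℝ) 1) :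
    deriv Real.smoothTransition u = 0 := by
  rw [Set.mem_Icc, not_and_or, not_le, not_le] at hu
  rcases hu with hu | hu
  · have : Real.smoothTransition =ᶠ[nhds u] fun _ => 0 :=
      (eventually_lt_nhds hu).mono fun v hv => Real.smoothTransition.zero_of_nonpos hv.le
    rw [this.deriv_eq, deriv_const]
  · have : Real.smoothTransition =ᶠ[nhds u] fun _ => 1 :=
      (eventually_gt_nhds hu).mono fun v hv => Real.smoothTransition.one_of_one_le hv.le
    rw [this.deriv_eq, deriv_const]

/-- Cut-off function of the ball of radius `ρ` as a function of `s = |x|²`; it vanishes if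
`n (ρ² - s) ≤ 1`. -/
def ballCutoff (ρ : ℝ) (n : ℕ) (s : ℝ) : ℝ := Real.smoothTransition (n * (ρ ^ 2 - s) - 1)

theorem ballCutoff_nonneg (ρ : ℝ) (n : ℕ) (s : ℝ) : 0 ≤ ballCutoff ρ n s :=
  Real.smoothTransition.nonneg _

theorem ballCutoff_le_one (ρ : ℝ) (n : ℕ) (s : ℝ) : ballCutoff ρ n s ≤ 1 :=
  Real.smoothTransition.le_one _

theorem hasDerivAt_ballCutoff (ρ : ℝ) (n : ℕ) (s : ℝ) :
    HasDerivAt (ballCutoff ρ n)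
      (deriv Real.smoothTransition (n * (ρ ^ 2 - s) - 1) * -n) s := by
  have h1 : HasDerivAt Real.smoothTransition
      (deriv Real.smoothTransition (n * (ρ ^ 2 - s) - 1)) (n * (ρ ^ 2 - s) - 1) :=
    ((Real.smoothTransition.contDiff (n := 1)).differentiable (by simp) _).hasDerivAt
  have h2 : HasDerivAt (fun s : ℝ => n * (ρ ^ 2 - s) - 1) (-n : ℝ) s := by
    simpa using (((hasDerivAt_id s).const_sub (ρ ^ 2)).const_mul (n : ℝ)).sub_const 1
  exact HasDerivAt.comp (h := fun s : ℝ => n * (ρ ^ 2 - s) - 1) s h1 h2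

theorem contDiff_ballCutoff (ρ : ℝ) (n : ℕ) : ContDiff ℝ ∞ (ballCutoff ρ n) :=
  Real.smoothTransition.contDiff.comp
    ((contDiff_const.mul (contDiff_const.sub contDiff_id)).sub contDiff_const)

theorem contDiff_radial_smul {h : ℝ → ℝ} {A : E3 → E3} (hh : ContDiff ℝ ∞ h)
    (hA : ContDiff ℝ ∞ A) : ContDiff ℝ ∞ (fun x => h (‖x‖ ^ 2) • A x) :=
  (hh.comp (contDiff_norm_sq ℝ)).smul hA

theorem tsupport_ballCutoff_smul_subset {ρ : ℝ} (hρ : 0 < ρ) (n : ℕ) (A : E3 → E3) :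
    tsupport (fun x => ballCutoff ρ n (‖x‖ ^ 2) • A x) ⊆ Metric.ball 0 ρ := by
  have hsub : tsupport (fun x => ballCutoff ρ n (‖x‖ ^ 2) • A x) ⊆
      {x | 1 ≤ (n : ℝ) * (ρ ^ 2 - ‖x‖ ^ 2)} := by
    refine closure_minimal (fun x hx => ?_)
      (isClosed_le continuous_const (by fun_prop))
    by_contra h
    refine hx ?_
    simp only [Set.mem_ofPred_eq, not_le] at h
    simp only [ballCutoff]
    rw [Real.smoothTransition.zero_of_nonpos (by linarith), zero_smul]
  refine hsub.trans fun x hx => ?_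
  simp only [Set.mem_ofPred_eq] at hx
  rw [mem_ball_zero_iff]
  by_contra! h
  have : ρ ^ 2 ≤ ‖x‖ ^ 2 := by gcongr
  nlinarith [Nat.cast_nonneg (α := ℝ) n]

/-- The derivative of the cut-off has size `n`, but it lives where `n (ρ² - |x|²) ≤ 2`. There `A`,
which vanishes on the sphere, is `O(1/n)`, so the product is bounded uniformly in `n`. -/
theorem exists_curl_ballCutoff_smul_bound {A : E3 → E3} (hA : ContDiff ℝ ∞ A) {ρ : ℝ}
    (hρ : 0 < ρ) (hA0 : ∀ x, ‖x‖ = ρ → A x = 0) :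
    ∃ C, ∀ n : ℕ, ∀ x, ‖x‖ ≤ ρ → ‖curl (fun x => ballCutoff ρ n (‖x‖ ^ 2) • A x) x‖ ≤ C := by
  obtain ⟨L, hL0, hL⟩ := exists_norm_le_mul_of_sphere_eq_zero hA hρ hA0
  obtain ⟨C, hC⟩ := (isCompact_closedBall (0 : E3) ρ).exists_bound_of_continuousOn
    (contDiff_curl hA).continuous.continuousOn
  obtain ⟨K, hK⟩ := (isCompact_Icc (a := (0 : ℝ)) (b := 1)).exists_bound_of_continuousOn
    ((Real.smoothTransition.contDiff (n := 1)).continuous_deriv (by simp)).continuousOn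
  have hK0 : 0 ≤ K := (norm_nonneg _).trans (hK 0 (by simp))
  refine ⟨C + 4 * K * L, fun n x hx => ?_⟩
  rw [curl_radial_smul (hasDerivAt_ballCutoff ρ n _) (hA.differentiable (by simp) x)]
  refine (norm_add_le _ _).trans (add_le_add ?_ ?_)
  · rw [norm_smul, Real.norm_of_nonneg (ballCutoff_nonneg ρ n _)]
    calc _ ≤ 1 * ‖curl A x‖ := by gcongr; exact ballCutoff_le_one ρ n _
      _ ≤ C := by rw [one_mul]; exact hC x (by simpa)
  · by_cases hu : (n : ℝ) * (ρ ^ 2 - ‖x‖ ^ 2) - 1 ∈ Set.Icc (0 : ℝ) 1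
    · have hd := hK _ hu
      have h1 : ‖cross x (A x)‖ ≤ ρ * (L * (ρ - ‖x‖)) :=
        (norm_cross_le _ _).trans (mul_le_mul hx (hL x hx) (norm_nonneg _) hρ.le)
      have h2 : (n : ℝ) * (ρ * (ρ - ‖x‖)) ≤ 2 := by
        have : ρ * (ρ - ‖x‖) ≤ ρ ^ 2 - ‖x‖ ^ 2 := by nlinarith [norm_nonneg x]
        have := mul_le_mul_of_nonneg_left this (Nat.cast_nonneg (α := ℝ) n)
        linarith [hu.2]
      rw [norm_smul, norm_mul, norm_mul, norm_neg, Real.norm_natCast, Real.norm_two]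
      calc _ ≤ 2 * (K * n) * (ρ * (L * (ρ - ‖x‖))) := by gcongr
        _ = 2 * K * L * (n * (ρ * (ρ - ‖x‖))) := by ring
        _ ≤ 2 * K * L * 2 := by gcongr
        _ = _ := by ring
    · rw [smoothTransition_deriv_eq_zero hu]
      simp only [zero_mul, mul_zero, zero_smul, norm_zero]
      positivity

/-- A weak curl in a ball can be tested with the extension by zero of a smooth field that vanishes
on the boundary of a smaller ball. -/
theorem integral_ball_eq_of_isWeakCurl {R ρ : ℝ} (hρ : 0 < ρ) (hρR : ρ ≤ R) {F G : E3 → E3}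
    (hF : IntegrableOn F (Metric.ball 0 R)) (hG : IntegrableOn G (Metric.ball 0 R))
    (hw : IsWeakCurl (Metric.ball 0 R) F G) {A : E3 → E3} (hA : ContDiff ℝ ∞ A)
    (hA0 : ∀ x, ‖x‖ = ρ → A x = 0) :
    ∫ x in Metric.ball 0 ρ, inner ℝ (G x) (A x) =
      ∫ x in Metric.ball 0 ρ, inner ℝ (F x) (curl A x) := by
  set φ : ℕ → E3 → E3 := fun n x => ballCutoff ρ n (‖x‖ ^ 2) • A x with hφ_def
  have hφ : ∀ n, ContDiff ℝ ∞ (φ n) := fun n => contDiff_radial_smul (contDiff_ballCutoff ρ n) hA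
  have hsub : Metric.ball (0 : E3) ρ ⊆ Metric.ball 0 R := Metric.ball_subset_ball hρR
  have hts : ∀ n, tsupport (φ n) ⊆ Metric.ball 0 ρ :=
    fun n => tsupport_ballCutoff_smul_subset hρ n A
  have hcs : ∀ n, HasCompactSupport (φ n) := fun n =>
    HasCompactSupport.of_support_subset_isCompact (isCompact_closedBall (0 : E3) ρ)
      ((subset_tsupport _).trans ((hts n).trans Metric.ball_subset_closedBall))
  have heq : ∀ n, ∫ x in Metric.ball 0 ρ, inner ℝ (G x) (φ n x) =
      ∫ x in Metric.ball 0 ρ, inner ℝ (F x) (curl (φ n) x) := by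
    intro n
    have h := hw (φ n) (hφ n) (hcs n) ((hts n).trans hsub)
    rwa [setIntegral_eq_of_subset_of_forall_sdiff_eq_zero measurableSet_ball hsub,
      setIntegral_eq_of_subset_of_forall_sdiff_eq_zero measurableSet_ball hsub] at h
    · intro x hx
      rw [image_eq_zero_of_notMem_tsupport
        fun h => hx.2 (hts n (tsupport_curl_subset _ h)), inner_zero_right]
    · intro x hx
      rw [image_eq_zero_of_notMem_tsupport fun h => hx.2 (hts n h), inner_zero_right]
  obtain ⟨C, hC⟩ := exists_curl_ballCutoff_smul_bound hA hρ hA0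
  obtain ⟨C', hC'⟩ := (isCompact_closedBall (0 : E3) ρ).exists_bound_of_continuousOn
    hA.continuous.continuousOn
  have hF' := hF.mono_set hsub
  have hG' := hG.mono_set hsub
  -- At each point of the open ball the cut-off is eventually `1` with zero derivative, so both
  -- integrands converge pointwise; the uniform bounds `C'` and `C` provide the majorants.
  have hlarge : ∀ x ∈ Metric.ball (0 : E3) ρ, ∀ᶠ n : ℕ in Filter.atTop,
      1 < (n : ℝ) * (ρ ^ 2 - ‖x‖ ^ 2) - 1 := by
    intro x hx
    have hx' : 0 < ρ ^ 2 - ‖x‖ ^ 2 := by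
      rw [mem_ball_zero_iff] at hx
      have := pow_lt_pow_left₀ hx (norm_nonneg x) (two_ne_zero)
      linarith
    have ht := (tendsto_natCast_atTop_atTop (R := ℝ)).atTop_mul_const hx'
    filter_upwards [ht.eventually_gt_atTop 2] with n hn
    linarith
  have limG : Filter.Tendsto (fun n => ∫ x in Metric.ball 0 ρ, inner ℝ (G x) (φ n x))
      Filter.atTop (nhds (∫ x in Metric.ball 0 ρ, inner ℝ (G x) (A x))) := by
    refine tendsto_integral_of_dominated_convergence (fun x => ‖G x‖ * C')
      (fun n => hG'.aestronglyMeasurable.inner (hφ n).continuous.aestronglyMeasurable)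
      (hG'.norm.mul_const C') (fun n => ?_) ?_
    · refine (ae_restrict_iff' measurableSet_ball).2 (Filter.Eventually.of_forall fun x hx => ?_)
      refine (norm_inner_le_norm _ _).trans ?_
      gcongr
      rw [hφ_def, norm_smul]
      rw [Real.norm_of_nonneg (ballCutoff_nonneg ρ n _)]
      calc _ ≤ 1 * ‖A x‖ := by gcongr; exact ballCutoff_le_one ρ n _
        _ ≤ C' := by rw [one_mul]; exact hC' x (Metric.ball_subset_closedBall hx)
    · refine (ae_restrict_iff' measurableSet_ball).2 (Filter.Eventually.of_forall fun x hx => ?_)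
      refine tendsto_const_nhds.congr' ((hlarge x hx).mono fun n hn => ?_)
      simp only [hφ_def, ballCutoff]
      rw [Real.smoothTransition.one_of_one_le hn.le, one_smul]
  have limF : Filter.Tendsto (fun n => ∫ x in Metric.ball 0 ρ, inner ℝ (F x) (curl (φ n) x))
      Filter.atTop (nhds (∫ x in Metric.ball 0 ρ, inner ℝ (F x) (curl A x))) := by
    refine tendsto_integral_of_dominated_convergence (fun x => ‖F x‖ * C)
      (fun n => hF'.aestronglyMeasurable.inner
        (contDiff_curl (hφ n)).continuous.aestronglyMeasurable)
      (hF'.norm.mul_const C) (fun n => ?_) ?_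
    · refine (ae_restrict_iff' measurableSet_ball).2 (Filter.Eventually.of_forall fun x hx => ?_)
      refine (norm_inner_le_norm _ _).trans ?_
      gcongr
      exact hC n x (mem_ball_zero_iff.1 hx).le
    · refine (ae_restrict_iff' measurableSet_ball).2 (Filter.Eventually.of_forall fun x hx => ?_)
      refine tendsto_const_nhds.congr' ((hlarge x hx).mono fun n hn => ?_)
      rw [hφ_def]
      simp only
      rw [curl_radial_smul (hasDerivAt_ballCutoff ρ n _) (hA.differentiable (by simp) x),
        smoothTransition_deriv_eq_zero fun h => absurd h.2 (not_le.2 hn)]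
      simp only [ballCutoff]
      rw [Real.smoothTransition.one_of_one_le hn.le]
      simp
  exact tendsto_nhds_unique limG ((funext heq) ▸ limF)

/-- Compact support of the test field is no restriction, since a bump function equal to `1` near the
ball changes nothing in the integrals. -/
theorem TangentialTraceZero.integral_eq {R : ℝ} {F G : E3 → E3}
    (h : TangentialTraceZero (Metric.ball 0 R) F G) {B : E3 → E3} (hB : ContDiff ℝ ∞ B) :
    ∫ x in Metric.ball 0 R, inner ℝ (G x) (B x) =
      ∫ x in Metric.ball 0 R, inner ℝ (F x) (curl B x) := by
  let η : ContDiffBump (0 : E3) := ⟨|R| + 1, |R| + 2, by positivity, by linarith⟩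
  have hη : ContDiff ℝ ∞ (fun x => η x • B x) := η.contDiff.smul hB
  have hev : ∀ x ∈ Metric.ball (0 : E3) R, (fun x => η x • B x) =ᶠ[nhds x] B := fun x hx => by
    have hx' : x ∈ Metric.ball (0 : E3) (|R| + 1) := by
      rw [mem_ball_zero_iff] at hx ⊢
      linarith [le_abs_self R]
    filter_upwards [Metric.isOpen_ball.mem_nhds hx'] with y hy
    rw [η.one_of_mem_closedBall (Metric.ball_subset_closedBall hy), one_smul]
  have := h _ hη η.hasCompactSupport.smul_right
  have e1 : ∫ x in Metric.ball 0 R, inner ℝ (G x) (η x • B x) =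
      ∫ x in Metric.ball 0 R, inner ℝ (G x) (B x) :=
    setIntegral_congr_fun measurableSet_ball fun x hx => by
      simp only [show η x • B x = B x from (hev x hx).eq_of_nhds]
  have e2 : ∫ x in Metric.ball 0 R, inner ℝ (F x) (curl (fun x => η x • B x) x) =
      ∫ x in Metric.ball 0 R, inner ℝ (F x) (curl B x) :=
    setIntegral_congr_fun measurableSet_ball fun x hx => by simp only [curl_congr (hev x hx)]
  rwa [e1, e2] at this

/-! ### Integration by parts for glued fields -/

theorem isFiniteMeasure_restrict_ball (R : ℝ) :
    IsFiniteMeasure (volume.restrict (Metric.ball (0 : E3) R)) :=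
  ⟨by rw [Measure.restrict_apply_univ]; exact measure_ball_lt_top⟩

/-- The field that is `A` on the closed unit ball and `B` outside. -/
def glue (A B : E3 → E3) (x : E3) : E3 := if ‖x‖ ≤ 1 then A x else B x

theorem stronglyMeasurable_glue {A B : E3 → E3} (hA : Continuous A) (hB : Continuous B) :
    StronglyMeasurable (glue A B) :=
  StronglyMeasurable.ite (measurableSet_le measurable_norm measurable_const)
    hA.stronglyMeasurable hB.stronglyMeasurable

theorem memLp_glue {A B : E3 → E3} (hA : Continuous A) (hB : Continuous B) (R : ℝ) :
    MemLp (glue A B) 2 (volume.restrict (Metric.ball 0 R)) := by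
  obtain ⟨C, hC⟩ := (isCompact_closedBall (0 : E3) R).exists_bound_of_continuousOn hA.continuousOn
  obtain ⟨C', hC'⟩ := (isCompact_closedBall (0 : E3) R).exists_bound_of_continuousOn hB.continuousOn
  have := isFiniteMeasure_restrict_ball R
  refine MemLp.of_bound (stronglyMeasurable_glue hA hB).aestronglyMeasurable (max C C')
    ((ae_restrict_iff' measurableSet_ball).2 (Filter.Eventually.of_forall fun x hx => ?_))
  have hx' := Metric.ball_subset_closedBall hx
  unfold glue
  split_ifs
  · exact (hC x hx').trans (le_max_left _ _)
  · exact (hC' x hx').trans (le_max_right _ _)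

theorem integrable_inner_of_continuous {R : ℝ} {G X : E3 → E3}
    (hG : IntegrableOn G (Metric.ball 0 R)) (hX : Continuous X) :
    IntegrableOn (fun x => inner ℝ (G x) (X x)) (Metric.ball 0 R) := by
  obtain ⟨C, hC⟩ := (isCompact_closedBall (0 : E3) R).exists_bound_of_continuousOn hX.continuousOn
  refine Integrable.mono' (hG.norm.mul_const C)
    (hG.aestronglyMeasurable.inner hX.aestronglyMeasurable)
    ((ae_restrict_iff' measurableSet_ball).2 (Filter.Eventually.of_forall fun x hx => ?_))
  refine (norm_inner_le_norm _ _).trans ?_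
  gcongr
  exact hC x (Metric.ball_subset_closedBall hx)

theorem integral_inner_glue {R : ℝ} (hR : 1 < R) {G X Y : E3 → E3}
    (hG : IntegrableOn G (Metric.ball 0 R)) (hX : Continuous X) (hY : Continuous Y) :
    ∫ x in Metric.ball 0 R, inner ℝ (G x) (glue X Y x) =
      (∫ x in Metric.ball 0 R, inner ℝ (G x) (Y x)) +
        ∫ x in Metric.ball 0 1, inner ℝ (G x) (X x - Y x) := by
  have hsub : Metric.closedBall (0 : E3) 1 ⊆ Metric.ball 0 R := Metric.closedBall_subset_ball hR
  -- `glue` switches on the closed ball; the sphere is a null set.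
  have hae : Metric.ball (0 : E3) 1 =ᵐ[volume] Metric.closedBall 0 1 :=
    ae_eq_of_subset_of_measure_ge Metric.ball_subset_closedBall
      (Measure.addHaar_closedBall_eq_addHaar_ball _ _ _).le
      measurableSet_ball.nullMeasurableSet measure_closedBall_lt_top.ne
  have hpt : ∀ x, inner ℝ (G x) (glue X Y x) = inner ℝ (G x) (Y x) +
      (Metric.closedBall (0 : E3) 1).indicator (fun x => inner ℝ (G x) (X x - Y x)) x := by
    intro x
    by_cases hx : ‖x‖ ≤ 1
    · simp [glue, hx, Set.indicator, inner_sub_right]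
    · simp [glue, hx, Set.indicator]
  have hXY : IntegrableOn (fun x => inner ℝ (G x) (X x - Y x)) (Metric.ball 0 R) :=
    integrable_inner_of_continuous hG (hX.sub hY)
  simp only [hpt]
  rw [integral_add (integrable_inner_of_continuous hG hY)
    (hXY.indicator measurableSet_closedBall),
    integral_indicator measurableSet_closedBall, Measure.restrict_restrict measurableSet_closedBall,
    Set.inter_eq_left.2 hsub, setIntegral_congr_set hae.symm]

/-- The correction `A - B` vanishes on the unit sphere and hence produces no interface term. The
boundary condition on the outer sphere enters only through `hFGB`, so it may come from `B` or from
`F`. -/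
theorem integral_inner_glue_curl {R : ℝ} (hR : 1 < R) {F G : E3 → E3}
    (hF : IntegrableOn F (Metric.ball 0 R)) (hG : IntegrableOn G (Metric.ball 0 R))
    (hw : IsWeakCurl (Metric.ball 0 R) F G) {A B : E3 → E3} (hA : ContDiff ℝ ∞ A)
    (hB : ContDiff ℝ ∞ B) (hAB : ∀ x, ‖x‖ = 1 → A x = B x)
    (hFGB : ∫ x in Metric.ball 0 R, inner ℝ (G x) (B x) =
      ∫ x in Metric.ball 0 R, inner ℝ (F x) (curl B x)) :
    ∫ x in Metric.ball 0 R, inner ℝ (G x) (glue A B x) =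
      ∫ x in Metric.ball 0 R, inner ℝ (F x) (glue (curl A) (curl B) x) := by
  rw [integral_inner_glue hR hG hA.continuous hB.continuous,
    integral_inner_glue hR hF (contDiff_curl hA).continuous (contDiff_curl hB).continuous, hFGB,
    integral_ball_eq_of_isWeakCurl one_pos hR.le hF hG hw (hA.sub hB)
      fun x hx => sub_eq_zero.2 (hAB x hx)]
  have : curl (fun x => A x - B x) = fun x => curl A x - curl B x := funext fun x =>
    curl_sub (hA.differentiable (by simp) x) (hB.differentiable (by simp) x)
  rw [this]

theorem integrableOn_ball_of_memLp {R : ℝ} {F : E3 → E3}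
    (h : MemLp F 2 (volume.restrict (Metric.ball 0 R))) : IntegrableOn F (Metric.ball 0 R) := by
  have := isFiniteMeasure_restrict_ball R
  exact h.integrable (by norm_num)

/-- A field which is smooth on both sides of the unit sphere and continuous across it, and which
vanishes on the sphere of radius `R`, belongs to `H₀(curl, B_R)`. -/
theorem memH0Curl_glue {R : ℝ} (hR : 1 < R) {A B : E3 → E3} (hA : ContDiff ℝ ∞ A)
    (hB : ContDiff ℝ ∞ B) (hAB : ∀ x, ‖x‖ = 1 → A x = B x) (hB0 : ∀ x, ‖x‖ = R → B x = 0) :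
    MemH0Curl (Metric.ball 0 R) (glue A B) (glue (curl A) (curl B)) := by
  have ht : TangentialTraceZero (Metric.ball 0 R) (glue A B) (glue (curl A) (curl B)) := by
    intro φ hφ hc
    have h1 : IntegrableOn φ (Metric.ball 0 R) :=
      (hφ.continuous.integrable_of_hasCompactSupport hc).integrableOn
    have h2 : IntegrableOn (curl φ) (Metric.ball 0 R) :=
      ((contDiff_curl hφ).continuous.integrable_of_hasCompactSupport
        (hc.of_isClosed_subset (isClosed_tsupport _) (tsupport_curl_subset φ))).integrableOn
    -- The roles are exchanged: `φ` is the field with a weak curl, and the glued field is what it is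
    -- tested with.
    have hw := isWeakCurl_curl hφ (Metric.ball 0 R)
    have := integral_inner_glue_curl hR h1 h2 hw hA hB hAB
      (integral_ball_eq_of_isWeakCurl (one_pos.trans hR) le_rfl h1 h2 hw hB hB0)
    simp only [real_inner_comm] at this ⊢
    exact this.symm
  exact ⟨memLp_glue hA.continuous hB.continuous R,
    memLp_glue (contDiff_curl hA).continuous (contDiff_curl hB).continuous R,
    fun φ hφ hc _ => ht φ hφ hc, ht⟩

/-! ### Homogeneity -/

theorem eval_smul_of_isHomogeneous {p : ℕ} {Q : MvPolynomial (Fin 3) ℝ} (hQ : Q.IsHomogeneous p)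
    (t : ℝ) (x : E3) :
    MvPolynomial.eval (fun j => (t • x) j) Q = t ^ p * MvPolynomial.eval (fun j => x j) Q := by
  rw [MvPolynomial.eval_eq', MvPolynomial.eval_eq', Finset.mul_sum]
  refine Finset.sum_congr rfl fun d hd => ?_
  have hdeg : ∑ i, d i = p := by
    rw [← hQ (MvPolynomial.mem_support_iff.1 hd), ← Finsupp.degree_eq_sum]
    exact DFunLike.congr_fun Finsupp.degree_eq_weight_one d
  simp only [PiLp.smul_apply, smul_eq_mul, mul_pow, Finset.prod_mul_distrib,
    Finset.prod_pow_eq_pow_sum, hdeg]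
  ring

theorem polyGrad_smul {p : ℕ} {P : MvPolynomial (Fin 3) ℝ} (hP : P.IsHomogeneous p) (t : ℝ)
    (x : E3) : polyGrad P (t • x) = t ^ (p - 1) • polyGrad P x := by
  ext i
  exact eval_smul_of_isHomogeneous hP.pderiv t x

/-- The cross product with `ω` removes the radial part subtracted in the surface gradient, and `ω ×
∇P(ω)` is homogeneous of degree `p` in `ω`. -/
theorem fieldV_unit {p : ℕ} {P : MvPolynomial (Fin 3) ℝ} (hp : 1 ≤ p) (hP : P.IsHomogeneous p)
    (x : E3) : fieldV p P (‖x‖⁻¹ • x) =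
      ((√((p : ℝ) * (p + 1)))⁻¹ * (‖x‖ ^ p)⁻¹) • cross x (polyGrad P x) := by
  obtain ⟨q, rfl⟩ : ∃ q, p = q + 1 := ⟨p - 1, by omega⟩
  unfold fieldV fieldU surfaceGrad
  rw [polyGrad_smul hP, Nat.add_sub_cancel, ← inv_pow, pow_succ]
  generalize (√(((q + 1 : ℕ) : ℝ) * ((q + 1 : ℕ) + 1)))⁻¹ = c
  generalize ‖x‖⁻¹ = r
  -- Its value is irrelevant, as it multiplies `ω × ω = 0`.
  generalize (inner ℝ (r • x) (r ^ q • polyGrad P x) : ℝ) = d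
  ext i; fin_cases i <;> simp [cross] <;> ring

/-! ### The radial profiles -/

/-- The profile of the separated field in the unit ball, as a function of `s = |x|²`. -/
def innerProfile (p : ℕ) (k s : ℝ) : ℝ :=
  -(√((p : ℝ) * (p + 1)) * besselAux p (k ^ 2))⁻¹ * besselAux p (k ^ 2 * s)

theorem hasDerivAt_besselAux_mul (p : ℕ) (a s : ℝ) :
    HasDerivAt (fun s => besselAux p (a * s)) (-(1 / 2) * a * besselAux (p + 1) (a * s)) s := by
  have h := HasDerivAt.comp (h := fun s : ℝ => a * s) s (hasDerivAt_besselAux p (a * s))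
    ((hasDerivAt_id s).const_mul a)
  refine HasDerivAt.congr_deriv h ?_
  ring

theorem contDiff_innerProfile (p : ℕ) (k : ℝ) : ContDiff ℝ ∞ (innerProfile p k) :=
  contDiff_const.mul ((contDiff_besselAux p).comp (contDiff_const.mul contDiff_id))

theorem deriv_innerProfile (p : ℕ) (k : ℝ) : deriv (innerProfile p k) = fun s =>
    (√((p : ℝ) * (p + 1)) * besselAux p (k ^ 2))⁻¹ * (k ^ 2 / 2) *
      besselAux (p + 1) (k ^ 2 * s) := by
  funext s
  refine (((hasDerivAt_besselAux_mul p (k ^ 2) s).const_mul _).congr_deriv ?_).deriv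
  ring

theorem innerProfile_ode (p : ℕ) (k s : ℝ) :
    4 * s * deriv (deriv (innerProfile p k)) s + (4 * p + 6) * deriv (innerProfile p k) s =
      -k ^ 2 * innerProfile p k s := by
  rw [deriv_innerProfile, ((hasDerivAt_besselAux_mul (p + 1) (k ^ 2) s).const_mul _).deriv]
  have := besselAux_recurrence p (k ^ 2 * s)
  unfold innerProfile
  linear_combination (√((p : ℝ) * (p + 1)) * besselAux p (k ^ 2))⁻¹ * k ^ 2 * this

/-- A smooth positive function that agrees with the identity on `[1/2, ∞)`. -/
def posExtension (s : ℝ) : ℝ := 1 + Real.smoothTransition (4 * s - 1) * (s - 1)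

theorem contDiff_posExtension : ContDiff ℝ ∞ posExtension :=
  contDiff_const.add ((Real.smoothTransition.contDiff.comp
    ((contDiff_const.mul contDiff_id).sub contDiff_const)).mul (contDiff_id.sub contDiff_const))

theorem posExtension_of_le {s : ℝ} (hs : 1 / 2 ≤ s) : posExtension s = s := by
  unfold posExtension
  rw [Real.smoothTransition.one_of_one_le (by linarith)]
  ring

theorem posExtension_pos (s : ℝ) : 0 < posExtension s := by
  unfold posExtension
  have h0 := Real.smoothTransition.nonneg (4 * s - 1)
  have h1 := Real.smoothTransition.le_one (4 * s - 1)
  -- The function is the convex combination `(1 - τ) + τ s`, with `τ = 0` for `s ≤ 1/4`.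
  rcases le_or_gt s (1 / 4) with hs | hs
  · rw [Real.smoothTransition.zero_of_nonpos (by linarith)]
    norm_num
  · nlinarith

/-- The profile of the separated field outside of the unit ball, as a function of `s = |x|²`;
it is smoothed out near `s = 0`. -/
def outerProfile (p : ℕ) (R s : ℝ) : ℝ :=
  (coeffC p R + coeffD p R * posExtension s ^ (-(2 * p + 1 : ℝ) / 2)) /
    √((p : ℝ) * (p + 1)) ^ 2

/-- Smoothness on the whole line makes the outer field smooth on all of space, as the gluing lemmas
require. -/
theorem contDiff_outerProfile (p : ℕ) (R : ℝ) : ContDiff ℝ ∞ (outerProfile p R) :=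
  (contDiff_const.add (contDiff_const.mul
    (contDiff_posExtension.rpow_const_of_ne fun s => (posExtension_pos s).ne'))).div_const _

theorem outerProfile_sq (p : ℕ) (R : ℝ) {r : ℝ} (hr : 1 ≤ r) : outerProfile p R (r ^ 2) =
    (coeffC p R + coeffD p R / r ^ (2 * p + 1)) / √((p : ℝ) * (p + 1)) ^ 2 := by
  have h0 : 0 ≤ r := by linarith
  unfold outerProfile
  rw [posExtension_of_le (by nlinarith), ← Real.rpow_natCast r 2, ← Real.rpow_mul h0,
    show ((2 : ℕ) : ℝ) * (-(2 * p + 1 : ℝ) / 2) = -((2 * p + 1 : ℕ) : ℝ) by push_cast; ring,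
    Real.rpow_neg h0, Real.rpow_natCast, div_eq_mul_inv (coeffD p R)]

theorem deriv_outerProfile (p : ℕ) (R : ℝ) {s : ℝ} (hs : 1 / 2 < s) :
    deriv (outerProfile p R) s =
      coeffD p R * (-(2 * p + 1 : ℝ) / 2 * s ^ (-(2 * p + 1 : ℝ) / 2 - 1)) /
        √((p : ℝ) * (p + 1)) ^ 2 := by
  have hev : outerProfile p R =ᶠ[nhds s] fun s =>
      (coeffC p R + coeffD p R * s ^ (-(2 * p + 1 : ℝ) / 2)) / √((p : ℝ) * (p + 1)) ^ 2 :=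
    (eventually_gt_nhds hs).mono fun u hu => by
      unfold outerProfile; rw [posExtension_of_le hu.le]
  rw [hev.deriv_eq]
  exact ((((Real.hasDerivAt_rpow_const (Or.inl (by linarith))).const_mul _).const_add _).div_const
    _).deriv

/-- A power `s^a` solves the equation when `4 a (a - 1) + (4p + 6) a = 0`, that is for `a = 0` or `a
= -(2p+1)/2`. -/
theorem outerProfile_ode (p : ℕ) (R : ℝ) {s : ℝ} (hs : 1 / 2 < s) :
    4 * s * deriv (deriv (outerProfile p R)) s + (4 * p + 6) * deriv (outerProfile p R) s = 0 := by
  have hs0 : 0 < s := by linarith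
  have hev : deriv (outerProfile p R) =ᶠ[nhds s] fun s =>
      coeffD p R * (-(2 * p + 1 : ℝ) / 2 * s ^ (-(2 * p + 1 : ℝ) / 2 - 1)) /
        √((p : ℝ) * (p + 1)) ^ 2 :=
    (eventually_gt_nhds hs).mono fun u hu => deriv_outerProfile p R hu
  have hd := (((((Real.hasDerivAt_rpow_const (p := -(2 * p + 1 : ℝ) / 2 - 1)
    (Or.inl hs0.ne')).const_mul (-(2 * p + 1 : ℝ) / 2)).const_mul (coeffD p R)).div_const
    (√((p : ℝ) * (p + 1)) ^ 2))).deriv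
  rw [hev.deriv_eq, hd, deriv_outerProfile p R hs]
  have : s ^ (-(2 * p + 1 : ℝ) / 2 - 1) = s ^ (-(2 * p + 1 : ℝ) / 2 - 1 - 1) * s := by
    rw [← Real.rpow_add_one hs0.ne']; ring_nf
  rw [this]
  ring

/-- The value `(2p+1) R^(2p+1) / (R^(2p+1) - 1)` of `k² γ_{p+1}(k²) / γ_p(k²)` for which the
separated field is an eigenfunction. -/
def interfaceRatio (p : ℕ) (R : ℝ) : ℝ := (2 * p + 1) * R ^ (2 * p + 1) / (R ^ (2 * p + 1) - 1)

/-! ### Matching of the two profiles -/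

section Interface

variable {p : ℕ} {R k : ℝ}

theorem sqrt_mul_succ_pos (hp : 1 ≤ p) : 0 < √((p : ℝ) * (p + 1)) :=
  Real.sqrt_pos.2 (by have : (1 : ℝ) ≤ p := by exact_mod_cast hp
                      positivity)

theorem profiles_one (hp : 1 ≤ p) (hR : 1 < R) (hk : besselAux p (k ^ 2) ≠ 0) :
    innerProfile p k 1 = outerProfile p R 1 := by
  have hc := (sqrt_mul_succ_pos hp).ne'
  have h1 := outerProfile_sq p R (le_refl 1)
  rw [one_pow, one_pow, div_one, coeffC_add_coeffD p hR] at h1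
  rw [h1]
  unfold innerProfile
  rw [mul_one]
  field_simp

/-- This is the condition that selects `k`: both sides equal `interfaceRatio p R / (2 √(p(p+1)))`.
-/
theorem deriv_profiles_one (hp : 1 ≤ p) (hk : besselAux p (k ^ 2) ≠ 0)
    (hkR : k ^ 2 * besselAux (p + 1) (k ^ 2) = interfaceRatio p R * besselAux p (k ^ 2)) :
    deriv (innerProfile p k) 1 = deriv (outerProfile p R) 1 := by
  have hc := (sqrt_mul_succ_pos hp).ne'
  rw [deriv_innerProfile, deriv_outerProfile p R (by norm_num)]
  simp only [mul_one, Real.one_rpow]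
  have e1 : (√((p : ℝ) * (p + 1)) * besselAux p (k ^ 2))⁻¹ * (k ^ 2 / 2) *
      besselAux (p + 1) (k ^ 2) = interfaceRatio p R / (2 * √((p : ℝ) * (p + 1))) := by
    field_simp
    linear_combination hkR
  rw [e1]
  unfold coeffD interfaceRatio
  generalize √((p : ℝ) * (p + 1)) = c at hc ⊢
  rw [div_eq_div_iff (by positivity) (by positivity)]
  ring

theorem outerProfile_boundary (p : ℕ) (hR : 1 < R) : outerProfile p R (R ^ 2) = 0 := by
  have h := coeff_boundary p hR
  have h0 : R ≠ 0 := by positivity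
  rw [outerProfile_sq p R hR.le, div_eq_zero_iff]
  left
  have : (coeffC p R + coeffD p R / R ^ (2 * p + 1)) * R ^ p = 0 := by
    rw [← h, two_mul, add_assoc, pow_add R p (p + 1)]
    field_simp
  exact (mul_eq_zero.1 this).resolve_right (pow_ne_zero _ h0)

theorem outerProfile_ne_zero (hp : 1 ≤ p) {r : ℝ} (hr : 1 < r) (hrR : r < R) :
    outerProfile p R (r ^ 2) ≠ 0 := by
  have hc := (sqrt_mul_succ_pos hp).ne'
  have h1 : 1 < r ^ (2 * p + 1) := one_lt_pow₀ hr (by omega)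
  have h2 : r ^ (2 * p + 1) < R ^ (2 * p + 1) :=
    pow_lt_pow_left₀ hrR (by linarith) (by omega)
  rw [outerProfile_sq p R hr.le]
  refine div_ne_zero ?_ (pow_ne_zero _ hc)
  unfold coeffC coeffD
  generalize √((p : ℝ) * (p + 1)) = c at hc ⊢
  generalize R ^ (2 * p + 1) = Q at *
  generalize r ^ (2 * p + 1) = q at *
  have hQ : Q - 1 ≠ 0 := by linarith
  have hq : q ≠ 0 := by linarith
  -- With `q = r^(2p+1)` and `Q = R^(2p+1)` the profile is a nonzero multiple of `q - Q`.
  have : c / (Q - 1) + -(c * Q / (Q - 1)) / q = c * (q - Q) / ((Q - 1) * q) := by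
    field_simp
    ring
  rw [this]
  exact div_ne_zero (mul_ne_zero hc (by linarith)) (mul_ne_zero hQ hq)

/-! ### The separated field -/

variable {P : MvPolynomial (Fin 3) ℝ}

/-- The powers of `k` cancel in `j_p(k r) / j_p(k) = r^p γ_p(k² r²) / γ_p(k²)`, and `r^p` cancels
against the `r^(-p)` of `V`. -/
theorem separatedField_eq_glue (hp : 1 ≤ p) (hP : P.IsHomogeneous p) (R : ℝ) (hk : 0 < k) :
    separatedField p P R k =
      glue (torField P (innerProfile p k)) (torField P (outerProfile p R)) := by
  funext x
  unfold separatedField glue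
  rw [fieldV_unit hp hP]
  split_ifs with hx
  · by_cases h0 : x = 0
    · subst h0
      have : cross 0 (polyGrad P 0) = 0 := by ext i; fin_cases i <;> simp [cross]
      simp [torField, this]
    · have hx0 : ‖x‖ ≠ 0 := norm_ne_zero_iff.2 h0
      rw [sphBessel_eq, sphBessel_eq, smul_smul]
      unfold torField innerProfile
      congr 1
      rw [mul_pow, mul_pow, mul_inv]
      have hk0 : k ^ p ≠ 0 := by positivity
      field_simp
  · have hx1 : 1 < ‖x‖ := not_le.1 hx
    have hx0 : ‖x‖ ≠ 0 := by positivity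
    rw [smul_smul]
    unfold torField
    rw [outerProfile_sq p R hx1.le]
    congr 1
    rw [two_mul, add_assoc, pow_add ‖x‖ p (p + 1)]
    have hc := (sqrt_mul_succ_pos hp).ne'
    field_simp

theorem curl_torField_eq (hP : IsSolidHarmonic p P) {g : ℝ → ℝ} (hg : ContDiff ℝ ∞ g) :
    curl (torField P g) = polField p P g (deriv g) :=
  funext fun _ => curl_torField hP (hg.differentiable (by simp) _).hasDerivAt

theorem contDiff_deriv {g : ℝ → ℝ} (hg : ContDiff ℝ ∞ g) : ContDiff ℝ ∞ (deriv g) :=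
  (contDiff_infty_iff_deriv.1 hg).2

theorem curl_polField_eq (P : MvPolynomial (Fin 3) ℝ) {g : ℝ → ℝ} (hg : ContDiff ℝ ∞ g) (x : E3) :
    curl (polField p P g (deriv g)) x =
      -(4 * ‖x‖ ^ 2 * deriv (deriv g) (‖x‖ ^ 2) + (4 * p + 6) * deriv g (‖x‖ ^ 2)) •
        cross x (polyGrad P x) :=
  curl_polField P (hg.differentiable (by simp) _).hasDerivAt
    ((contDiff_deriv hg).differentiable (by simp) _).hasDerivAt

/-! ### Non-vanishing in the shell -/

theorem eq_zero_of_eval_shell_eq_zero (hp : 1 ≤ p) (hP : P.IsHomogeneous p) (hR : 1 < R)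
    (h : ∀ x : E3, 1 < ‖x‖ → ‖x‖ < R → MvPolynomial.eval (fun j => x j) P = 0) : P = 0 := by
  refine MvPolynomial.funext fun y => ?_
  rw [map_zero]
  have hscale := fun t => eval_smul_of_isHomogeneous hP t (WithLp.toLp 2 y)
  by_cases hy : (WithLp.toLp 2 y : E3) = 0
  · have h0 := hscale 0
    have e : (0 : ℝ) • (WithLp.toLp 2 y : E3) = WithLp.toLp 2 y := by rw [hy, smul_zero]
    rw [e, zero_pow (by omega), zero_mul] at h0
    exact h0
  · have hy0 : 0 < ‖(WithLp.toLp 2 y : E3)‖ := norm_pos_iff.2 hy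
    -- By homogeneity it suffices to evaluate at the point of the ray with norm `(1 + R) / 2`, which
    -- lies in the shell.
    have ht : 0 < (1 + R) / 2 / ‖(WithLp.toLp 2 y : E3)‖ := by positivity
    have hn : ‖((1 + R) / 2 / ‖(WithLp.toLp 2 y : E3)‖) • (WithLp.toLp 2 y : E3)‖ = (1 + R) / 2 := by
      rw [norm_smul, Real.norm_of_nonneg ht.le]
      field_simp
    have h1 := hscale ((1 + R) / 2 / ‖(WithLp.toLp 2 y : E3)‖)
    rw [h _ (by rw [hn]; linarith) (by rw [hn]; linarith)] at h1
    exact (mul_eq_zero.1 h1.symm).resolve_left (pow_ne_zero _ ht.ne')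

theorem isOpen_shell (R : ℝ) : IsOpen (Metric.ball (0 : E3) R \ Metric.closedBall 0 1) :=
  Metric.isOpen_ball.sdiff Metric.isClosed_closedBall

/-- Excludes both an electrostatic field and `E = 0`. The function `g₁` is arbitrary because only
the radial component is used. -/
theorem not_polField_eq_zero_shell (hp : 1 ≤ p) (hP : IsSolidHarmonic p P) (hP0 : P ≠ 0)
    (hR : 1 < R) (g₁ : ℝ → ℝ) :
    ¬ ∀ x ∈ Metric.ball (0 : E3) R \ Metric.closedBall 0 1,
      polField p P (outerProfile p R) g₁ x = 0 := by
  intro h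
  refine hP0 (eq_zero_of_eval_shell_eq_zero hp hP.1 hR fun x h1 h2 => ?_)
  have hi := inner_polField hP (outerProfile p R) g₁ x
  rw [h x ⟨by simpa using h2, by simpa using h1⟩, inner_zero_left, eq_comm, neg_eq_zero] at hi
  have hp0 : (p : ℝ) * (p + 1) ≠ 0 := by
    have : (1 : ℝ) ≤ p := by exact_mod_cast hp
    positivity
  exact (mul_eq_zero.1 hi).resolve_left (mul_ne_zero hp0 (outerProfile_ne_zero hp h1 h2))

theorem glue_ae_eq_zero_shell {A B : E3 → E3} (hB : Continuous B)
    (h : glue A B =ᵐ[volume.restrict (Metric.ball (0 : E3) R \ Metric.closedBall 0 1)] 0) :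
    ∀ x ∈ Metric.ball (0 : E3) R \ Metric.closedBall 0 1, B x = 0 := by
  have hB0 : B =ᵐ[volume.restrict (Metric.ball (0 : E3) R \ Metric.closedBall 0 1)] 0 := by
    filter_upwards [h, ae_restrict_mem (isOpen_shell R).measurableSet] with x hx hs
    have : ¬ ‖x‖ ≤ 1 := by simpa using hs.2
    simpa [glue, this] using hx
  exact Measure.eqOn_open_of_ae_eq hB0 (isOpen_shell R) hB.continuousOn continuousOn_const

/-! ### Eigenfunctions and infinitely many eigenvalues -/

theorem isEigenfunction_separatedField (hp : 1 ≤ p) (hP : IsSolidHarmonic p P) (hP0 : P ≠ 0)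
    (hR : 1 < R) (hk : 0 < k) (hγ : besselAux p (k ^ 2) ≠ 0)
    (hkR : k ^ 2 * besselAux (p + 1) (k ^ 2) = interfaceRatio p R * besselAux p (k ^ 2)) :
    ∃ H, IsEigenfunction (Metric.ball 0 1) (Metric.ball 0 R) (k ^ 2) (separatedField p P R k) H ∧
      ¬ IsElectrostatic (Metric.ball 0 1) (Metric.ball 0 R) H := by
  have hgi := contDiff_innerProfile p k
  have hgo := contDiff_outerProfile p R
  have hA := contDiff_torField P hgi
  have hB := contDiff_torField P hgo
  have hA2 := contDiff_polField p P hgi (contDiff_deriv hgi)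
  have hB2 := contDiff_polField p P hgo (contDiff_deriv hgo)
  have hcA := curl_torField_eq hP hgi
  have hcB := curl_torField_eq hP hgo
  have hE := separatedField_eq_glue hp hP.1 R hk
  have hmem : MemH0Curl (Metric.ball 0 R) (separatedField p P R k)
      (glue (polField p P (innerProfile p k) (deriv (innerProfile p k)))
        (polField p P (outerProfile p R) (deriv (outerProfile p R)))) := by
    rw [hE, ← hcA, ← hcB]
    refine memH0Curl_glue hR hA hB (fun x hx => ?_) fun x hx => ?_
    · simp only [torField, hx, one_pow, profiles_one hp hR hγ]
    · simp only [torField, hx, outerProfile_boundary p hR, zero_smul]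
  refine ⟨_, ⟨hmem, by positivity, fun h => ?_, fun F G hFG => ?_⟩, fun h => ?_⟩
  · rw [hE] at h
    have h0 := glue_ae_eq_zero_shell hB.continuous
      (ae_restrict_of_ae_restrict_of_subset Set.sdiff_subset h)
    -- If `E` vanishes on the open shell, so does its curl.
    refine not_polField_eq_zero_shell hp hP hP0 hR (deriv (outerProfile p R)) fun x hx => ?_
    rw [← hcB, curl_congr (ψ := fun _ => 0)
      (Filter.eventually_of_mem ((isOpen_shell R).mem_nhds hx) h0), curl_zero]
  · have hF := integrableOn_ball_of_memLp hFG.memLp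
    have hG := integrableOn_ball_of_memLp hFG.memLp_curl
    -- Here the glued field is `curl E`. On the unit sphere it depends on `g(1)` and `g'(1)` only,
    -- so the two matching conditions make it continuous; the outer boundary term vanishes by the
    -- trace condition on `F`.
    have hmain := integral_inner_glue_curl hR hF hG hFG.isWeakCurl hA2 hB2 (fun x hx => by
      simp only [polField, hx, one_pow, profiles_one hp hR hγ, deriv_profiles_one hp hγ hkR])
      (hFG.trace_zero.integral_eq hB2)
    have hcurl : glue (curl (polField p P (innerProfile p k) (deriv (innerProfile p k))))
        (curl (polField p P (outerProfile p R) (deriv (outerProfile p R)))) =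
        glue (fun x => k ^ 2 • torField P (innerProfile p k) x) fun _ => 0 := by
      funext x
      unfold glue
      split_ifs with hx
      · simp only [torField]
        rw [curl_polField_eq P hgi, innerProfile_ode, smul_smul, neg_mul, neg_neg]
      · have hx1 : 1 < ‖x‖ := not_le.1 hx
        rw [curl_polField_eq P hgo, outerProfile_ode p R (by nlinarith), neg_zero, zero_smul]
    have hAk : Continuous fun x => k ^ 2 • torField P (innerProfile p k) x := by
      have := hA.continuous
      fun_prop
    rw [hcurl, integral_inner_glue hR hF hAk continuous_const] at hmain
    simp only [inner_zero_right, integral_zero, zero_add, sub_zero, inner_smul_right] at hmain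
    rw [integral_const_mul] at hmain
    simp only [real_inner_comm] at hmain ⊢
    rw [hmain]
    congr 1
    refine setIntegral_congr_fun measurableSet_ball fun x hx => ?_
    have hx1 : ‖x‖ ≤ 1 := (mem_ball_zero_iff.1 hx).le
    simp only [hE, glue, hx1, if_true]
  · unfold IsElectrostatic at h
    rw [closure_ball _ one_ne_zero] at h
    exact not_polField_eq_zero_shell hp hP hP0 hR _ (glue_ae_eq_zero_shell hB2.continuous h)

theorem infinite_eigenfunctions (hp : 1 ≤ p) (hP : IsSolidHarmonic p P) (hP0 : P ≠ 0)
    (hR : 1 < R) :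
    {k : ℝ | 0 < k ∧ sphBessel p k ≠ 0 ∧ ∃ H : E3 → E3,
      IsEigenfunction (Metric.ball 0 1) (Metric.ball 0 R) (k ^ 2) (separatedField p P R k) H ∧
      ¬ IsElectrostatic (Metric.ball 0 1) (Metric.ball 0 R) H}.Infinite := by
  refine Set.infinite_of_forall_exists_gt fun T => ?_
  -- `T` may be negative, so it is replaced by `max T 0` before squaring.
  obtain ⟨t, hT, ht0, ht⟩ := exists_besselAux_ratio p (interfaceRatio p R) (max T 0 ^ 2)
  have hk : max T 0 < √t := Real.lt_sqrt_of_sq_lt hT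
  have hk0 : 0 < √t := (le_max_right _ _).trans_lt hk
  have hsq : √t ^ 2 = t := Real.sq_sqrt ((sq_nonneg _).trans hT.le)
  refine ⟨√t, ⟨hk0, ?_, isEigenfunction_separatedField hp hP hP0 hR hk0 ?_ ?_⟩,
    (le_max_left _ _).trans_lt hk⟩
  · rw [sphBessel_eq, hsq]
    exact mul_ne_zero (by positivity) ht0
  · rwa [hsq]
  · rwa [hsq]

end Interface

theorem isSolidHarmonic_X (i : Fin 3) : IsSolidHarmonic 1 (MvPolynomial.X i) :=
  ⟨MvPolynomial.isHomogeneous_X ℝ i, Finset.sum_eq_zero fun j _ => by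
    by_cases h : j = i <;> simp [MvPolynomial.pderiv_X, h]⟩

end MaxwellENZ

end

theorem theorem4p5 (R : ℝ) (hR : 1 < R) :
    {lam : ℝ | 0 < lam ∧ ∃ E H : MaxwellENZ.E3 → MaxwellENZ.E3,
      MaxwellENZ.IsEigenfunction (Metric.ball 0 1) (Metric.ball 0 R) lam E H ∧
      ¬ MaxwellENZ.IsElectrostatic (Metric.ball 0 1) (Metric.ball 0 R) H}.Infinite ∧
    ∀ (p : ℕ) (P : MvPolynomial (Fin 3) ℝ), 1 ≤ p → MaxwellENZ.IsSolidHarmonic p P → P ≠ 0 →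
      {k : ℝ | 0 < k ∧ MaxwellENZ.sphBessel p k ≠ 0 ∧ ∃ H : MaxwellENZ.E3 → MaxwellENZ.E3,
        MaxwellENZ.IsEigenfunction (Metric.ball 0 1) (Metric.ball 0 R) (k ^ 2)
          (MaxwellENZ.separatedField p P R k) H ∧
        ¬ MaxwellENZ.IsElectrostatic (Metric.ball 0 1) (Metric.ball 0 R) H}.Infinite := by
  refine ⟨?_, fun p P hp hP hP0 => MaxwellENZ.infinite_eigenfunctions hp hP hP0 hR⟩
  -- A single harmonic suffices, here a coordinate with `p = 1`; `k ↦ k²` is injective on positive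
  -- numbers.
  have h := MaxwellENZ.infinite_eigenfunctions le_rfl (MaxwellENZ.isSolidHarmonic_X 0)
    (MvPolynomial.X_ne_zero 0) hR
  refine (h.image (f := fun k => k ^ 2) fun a ha b hb hab => ?_).mono ?_
  · exact (pow_left_inj₀ ha.1.le hb.1.le two_ne_zero).1 hab
  · rintro _ ⟨k, ⟨hk, -, H, hH⟩, rfl⟩
    exact ⟨pow_pos hk 2, _, H, hH⟩
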